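/- Let $K$ be an algebraically closed field of characteristic $0$ (for instance $\mathbb C$). Let $\mathfrak g$ be a finite-dimensional simple Lie algebra over $K$ with Cartan subalgebra $\mathfrak t$, root system $\Delta$, simple roots $\Pi$, positive roots $\Delta^+$ and Borel subalgebra $\mathfrak b=\mathfrak t\oplus\bigoplus_{\alpha\in\Delta^+}\mathfrak g_\alpha$. Let $\theta$ be the highest root and $\theta_s$ the short dominant root, and assume that $|\theta|^2/|\theta_s|^2=2$. Let $\Delta^+_l$ be the set of long positive roots. A subset $I\subset\Delta^+$ is called an Abelian ideal if (a) $\mu+\nu\notin\Delta$ for all $\mu,\nu\in I$, and (b) whenever $\gamma\in I$, $\nu\in\Delta^+$ and $\gamma+\nu\in\Delta$, then $\gamma+\nu\in I$; it is called long if moreover $I\subset\Delta^+_l$. Let $\mathfrak g^\vee$ be the Langlands dual simple Lie algebra, with Cartan subalgebra $\mathfrak t^\vee$ and root system identified with $\Delta^\vee=\{\alpha^\vee : \alpha\in\Delta\}$, and let $\mathfrak b^\vee$ be its Borel subalgebra with positive roots $(\Delta^+)^\vee$. Let $V=V(\theta^\vee)$ be the irreducible $\mathfrak g^\vee$-module with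 highest weight $\theta^\vee$ (the little adjoint module), and let $\tilde{\mathfrak g}=\mathfrak g^\vee\oplus V$ be a finite-dimensional simple $\mathbb Z_2$-graded Lie algebra with even part $\mathfrak g^\vee$ and odd part the $\mathfrak g^\vee$-module $V$. For $I\subset\Delta^+_l$ put $I^\vee=\{\alpha^\vee : \alpha\in I\}$, and let $\mathfrak a(I^\vee)\subset V$ be the sum of the weight spaces of $V$ for the weights in $I^\vee$. Theorem. (1) For every $I\subset\Delta^+_l$, the following are equivalent: $I$ is an Abelian ideal; the subspace $\bigoplus_{\alpha\in I}\mathfrak g_\alpha$ is an Abelian ideal of $\mathfrak b$; the subspace $\mathfrak a(I^\vee)$ is a $\mathfrak b^\vee$-stable commutative subalgebra of $\tilde{\mathfrak g}$. (2) The map $I\mapsto\mathfrak a(I^\vee)$ is a bijection from the set of long Abelian ideals onto the set of all $\mathfrak b^\vee$-stable commutative subalgebras of $\tilde{\mathfrak g}$ that are contained in $V$. -/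

import Mathlib

open LieAlgebra LieAlgebra.IsKilling Module

namespace LongAbelian

section Roots

variable {ι R M N : Type*} [Fintype ι] [Field R] [CharZero R] [AddCommGroup M] [Module R M]
  [AddCommGroup N] [Module R N] (P : RootPairing ι R M N) [P.IsCrystallographic]

/-- The squared length of a root, with respect to the canonical Weyl-invariant positive definite
form on the root lattice. -/
noncomputable def sqLength (i : ι) : ℤ :=
  (P.posRootForm ℤ).rootLength i

/-- A root is long if it has the maximal length among all roots. -/
def IsLong (i : ι) : Prop :=
  ∀ j, sqLength P j ≤ sqLength P i

/-- A root is short if some root is strictly longer. -/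
def IsShort (i : ι) : Prop :=
  ∃ j, sqLength P i < sqLength P j

variable {P}

/-- The highest root: `θ - α` is a non-negative integral combination of simple roots, for every
root `α`. -/
def IsHighestRoot (b : P.Base) (θ : ι) : Prop :=
  ∀ j, P.root θ - P.root j ∈ AddSubmonoid.closure (P.root '' b.support)

/-- A dominant root: its pairing with every simple coroot is non-negative. -/
def IsDominant (b : P.Base) (i : ι) : Prop :=
  ∀ j ∈ b.support, 0 ≤ P.pairingIn ℤ i j

/-- Sets of long positive roots. -/
def IsLongPositive (b : P.Base) (I : Set ι) : Prop :=
  ∀ i ∈ I, b.IsPos i ∧ IsLong P i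

/-- (Combinatorial) Abelian ideals: sets `I` of positive roots such that no sum of two members
of `I` is a root, and such that `γ + ν ∈ I` whenever `γ ∈ I`, `ν` is a positive root and `γ + ν` is
a root. -/
structure IsAbelianIdeal (b : P.Base) (I : Set ι) : Prop where
  isPos : ∀ i ∈ I, b.IsPos i
  add_notMem : ∀ i ∈ I, ∀ j ∈ I, P.root i + P.root j ∉ Set.range P.root
  add_mem : ∀ i ∈ I, ∀ j, b.IsPos j → ∀ k, P.root k = P.root i + P.root j → k ∈ I

end Roots

section Lie

variable {K L : Type*} [Field K] [CharZero K] [LieRing L] [LieAlgebra K L]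
  [FiniteDimensional K L] (H : LieSubalgebra K L) [H.IsCartanSubalgebra]

/-- The sum of the root spaces of the roots in `S`. -/
noncomputable def rootSpaceSum (S : Set H.root) : Submodule K L :=
  ⨆ i ∈ S, (rootSpace H i.1).toSubmodule

/-- The (underlying subspace of the) Borel subalgebra containing the Cartan subalgebra `H` and
having `S` as its set of positive roots: the sum of `H` and of the root spaces of the roots
in `S`. -/
noncomputable def borel (S : Set H.root) : Submodule K L :=
  H.toSubmodule ⊔ rootSpaceSum H S

/-- The subspace `a` is an Abelian ideal of the Borel subalgebra with positive roots `S`. -/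
structure IsAbelianBorelIdeal (S : Set H.root) (a : Submodule K L) : Prop where
  le_borel : a ≤ borel H S
  lie_mem : ∀ x ∈ borel H S, ∀ y ∈ a, ⁅x, y⁆ ∈ a
  lie_eq_zero : ∀ x ∈ a, ∀ y ∈ a, ⁅x, y⁆ = 0

/-- `M` is the irreducible `L`-module with highest weight `χ`, relative to the Borel subalgebra
with positive roots `S`. -/
structure IsHighestWeightModule (S : Set H.root) (M : Type*) [AddCommGroup M] [Module K M]
    [LieRingModule L M] [LieModule K L M] (χ : H → K) : Prop where
  irreducible : LieModule.IsIrreducible K L M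
  exists_highest : ∃ v : M, v ≠ 0 ∧ (∀ h : H, ⁅(h : L), v⁆ = χ h • v) ∧
    ∀ i ∈ S, ∀ x ∈ rootSpace H i.1, ⁅x, v⁆ = 0

end Lie

section Graded

variable {K G : Type*} [Field K] [LieRing G] [LieAlgebra K G]

/-- `G = D ⊕ V` is a `ℤ/2`-grading of the Lie algebra `G` with even part the subalgebra `D` and odd
part the `D`-submodule `V`. -/
structure IsZ2Grading (D : LieSubalgebra K G) (V : LieSubmodule K D G) : Prop where
  isCompl : IsCompl D.toSubmodule V.toSubmodule
  lie_mem : ∀ x ∈ V, ∀ y ∈ V, ⁅x, y⁆ ∈ D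

/-- A subspace of a Lie algebra which is a commutative Lie subalgebra. -/
def IsCommutativeSubalgebra (a : Submodule K G) : Prop :=
  ∃ s : LieSubalgebra K G, s.toSubmodule = a ∧ IsLieAbelian s

variable [CharZero K] [FiniteDimensional K G] {D : LieSubalgebra K G}
  (H : LieSubalgebra K D) [H.IsCartanSubalgebra] (V : LieSubmodule K D G)

/-- The sum, as a subspace of `G`, of the weight spaces of the `D`-module `V` (with respect to the
Cartan subalgebra `H` of `D`) for the weights in the set `S` of roots. -/
noncomputable def weightSpaceSum (S : Set H.root) : Submodule K G :=
  ⨆ i ∈ S, (LieModule.weightSpace V (i.1 : H → K)).toSubmodule.map V.toSubmodule.subtype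

/-- The subspace `a` of `V` is a commutative subalgebra of `G`, and is stable under the Borel
subalgebra of `D` with positive roots `S`. -/
structure IsStableCommutative (S : Set H.root) (a : Submodule K G) : Prop where
  le_odd : a ≤ V.toSubmodule
  lie_mem : ∀ x ∈ borel H S, ∀ v ∈ a, ⁅x, v⁆ ∈ a
  commutative : IsCommutativeSubalgebra a

end Graded

end LongAbelian

set_option linter.unusedSectionVars false

/-! Write `α^∨` for the weight `dualRoot e α` of the dual algebra `D`. The first point is that the
weights of `V` are `0` and the `α^∨` with `α` long (`iSup_wt_eq_top`). Reflections carry `θ^∨` to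
every such `α^∨`. Conversely, `α^∨ + β^∨` is never a weight when `α` is long and `⟨β, α^∨⟩ ≥ 0`: by
reflections this reduces to `α = θ`, where such a weight, possibly after one more reflection, lies
above the highest one. The second point is that brackets vanish only when they must. The Killing
form of `G` makes `D` and `V` orthogonal and pairs `V_χ` with `V_{-χ}` nondegenerately. Hence odd
root vectors lie in `sl₂`-triples, odd root weight spaces are at most lines, and `[V_α, V_β] ≠ 0`
for suitable roots `α`, `β`, `α + β` of `D` (`IsZ2Grading.lie_ne_zero`). The rest is root
combinatorics at length ratio 2, modelled on the subsystem `B₂` with long roots `ε₁ ± ε₂` and short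
roots `±ε₁`, `±ε₂`. Long roots add exactly when their coroots add to a long root's coroot. If the
coroots of two long members of an ideal add to the coroot of a short root `κ`, then adding some
positive root to one of them gives `κ`, so the ideal is not long. Conversely, if `α` is long and `α
+ β` is a root with `β` short positive, then stability forces `α + 2β` into the set, and the odd
vectors for `α` and `α + 2β` do not commute. Finally, a stable commutative `a ⊆ V` is a sum of
weight spaces. It has no vector of weight `0` (`IsStableCommutative.eq_zero_of_mem_wt_zero`), hence
none of negative weight, since raising such a vector would give one of weight `0`. So `a` comes from
long positive roots. -/

namespace LongAbelian

/-! ### Weight vectors and subspaces stable under a Cartan subalgebra -/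

section WeightVectors

variable {K D : Type*} [Field K] [LieRing D] [LieAlgebra K D] (H : LieSubalgebra K D)
  (M : Type*) [AddCommGroup M] [Module K M] [LieRingModule D M] [LieModule K D M]

/-- The vectors of weight `χ` in a module, with respect to the subalgebra `H`. -/
def wt (χ : Dual K H) : Submodule K M where
  carrier := {m | ∀ h : H, ⁅(h : D), m⁆ = χ h • m}
  zero_mem' := by simp
  add_mem' {a b} ha hb h := by simp [ha h, hb h]
  smul_mem' c a ha h := by simp [ha h, smul_comm c]

variable {H M}

/-- A subspace stable under the subalgebra `H` contains the weight components of its elements. -/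
lemma component_mem (a : Submodule K M) (ha : ∀ h : H, ∀ m ∈ a, ⁅(h : D), m⁆ ∈ a)
    (F : Finset (Dual K H)) (v : Dual K H → M) (hv : ∀ χ ∈ F, v χ ∈ wt H M χ)
    (hsum : ∑ χ ∈ F, v χ ∈ a) : ∀ χ ∈ F, v χ ∈ a := by
  classical
  induction F using Finset.induction_on generalizing v with
  | empty => simp
  | insert ψ F hψ ih =>
    have key : ∀ χ ∈ F, v χ ∈ a := by
      intro χ hχ
      obtain ⟨h, hh⟩ : ∃ h, χ h - ψ h ≠ 0 := by
        by_contra! hc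
        exact hψ ((LinearMap.ext fun h ↦ sub_eq_zero.mp (hc h) : χ = ψ) ▸ hχ)
      -- The operator `h - ψ h` kills the `ψ`-component and rescales the others, that of `χ` by a
      -- nonzero scalar.
      have h1 := ih (fun φ ↦ (φ h - ψ h) • v φ)
        (fun φ hφ ↦ Submodule.smul_mem _ _ (hv φ (Finset.mem_insert_of_mem hφ))) (by
          have h2 := a.sub_mem (ha h _ hsum) (a.smul_mem (ψ h) hsum)
          rw [Finset.sum_insert hψ, lie_add, hv ψ (Finset.mem_insert_self _ _) h, smul_add,
            add_sub_add_left_eq_sub, lie_sum, Finset.smul_sum, ← Finset.sum_sub_distrib] at h2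
          convert! h2 using 2 with φ hφ
          rw [hv φ (Finset.mem_insert_of_mem hφ) h, sub_smul]) χ hχ
      simpa [hh] using a.smul_mem (χ h - ψ h)⁻¹ h1
    intro χ hχ
    rcases Finset.mem_insert.mp hχ with rfl | hχ
    · rw [Finset.sum_insert hψ] at hsum
      simpa using a.sub_mem hsum (a.sum_mem key)
    · exact key χ hχ

lemma exists_components_of_mem_biSup {U : Dual K H → Submodule K M} {Λ : Set (Dual K H)} {x : M}
    (hx : x ∈ ⨆ χ ∈ Λ, U χ) :
    ∃ f : Dual K H →₀ M, (∀ χ ∈ f.support, χ ∈ Λ ∧ f χ ∈ U χ) ∧ ∑ χ ∈ f.support, f χ = x := by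
  obtain ⟨f, hf, hfx⟩ := (Submodule.mem_iSup_iff_exists_finsupp _ x).mp hx
  refine ⟨f, fun χ hχ ↦ ?_, hfx⟩
  by_cases h : χ ∈ Λ
  · exact ⟨h, by simpa [h] using hf χ⟩
  · exact absurd (by simpa [h] using hf χ) (Finsupp.mem_support_iff.mp hχ)

/-- An `H`-stable subspace of a sum of subspaces of weight spaces is the sum of its intersections
with these. -/
lemma le_biSup_inf_of_stable {U : Dual K H → Submodule K M} (hU : ∀ χ, U χ ≤ wt H M χ)
    {Λ : Set (Dual K H)} {a : Submodule K M} (ha : ∀ h : H, ∀ m ∈ a, ⁅(h : D), m⁆ ∈ a)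
    (hle : a ≤ ⨆ χ ∈ Λ, U χ) : a ≤ ⨆ χ ∈ Λ, U χ ⊓ a := by
  intro x hx
  obtain ⟨f, hf, rfl⟩ := exists_components_of_mem_biSup (hle hx)
  have := component_mem a ha f.support f (fun χ hχ ↦ hU χ (hf χ hχ).2) hx
  exact Submodule.sum_mem _ fun χ hχ ↦
    Submodule.mem_iSup_of_mem χ (Submodule.mem_iSup_of_mem (hf χ hχ).1 ⟨(hf χ hχ).2, this χ hχ⟩)

/-- Weight spaces of different weights are independent. -/
lemma mem_of_mem_wt_of_mem_biSup {U : Dual K H → Submodule K M} (hU : ∀ χ, U χ ≤ wt H M χ)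
    {Λ : Set (Dual K H)} {μ : Dual K H} {x : M} (hx0 : x ≠ 0) (hx : x ∈ wt H M μ)
    (hxΛ : x ∈ ⨆ χ ∈ Λ, U χ) : μ ∈ Λ := by
  classical
  obtain ⟨f, hf, rfl⟩ := exists_components_of_mem_biSup hxΛ
  by_contra hμ
  have hμf : μ ∉ f.support := fun h ↦ hμ (hf μ h).1
  set v : Dual K H → M := fun χ ↦ if χ = μ then -∑ χ ∈ f.support, f χ else f χ
  have hv : ∀ χ ∈ f.support, v χ = f χ := fun χ hχ ↦ if_neg (by rintro rfl; exact hμf hχ)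
  have := component_mem (⊥ : Submodule K M) (by simp) (insert μ f.support) v (by
      intro χ hχ
      rcases Finset.mem_insert.mp hχ with rfl | hχ
      · simpa [v] using hx
      · rw [hv χ hχ]; exact hU χ (hf χ hχ).2) (by
      rw [Finset.sum_insert hμf, Finset.sum_congr rfl hv]; simp [v]) μ (by simp)
  exact hx0 (by simpa [v] using this)

lemma lie_mem_wt_of_forall_lie_eq {χ : Dual K H} {m : M} (hm : m ∈ wt H M χ) {ψ : Dual K H} {x : D}
    (hx : ∀ h : H, ⁅(h : D), x⁆ = ψ h • x) : ⁅x, m⁆ ∈ wt H M (ψ + χ) := by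
  intro h
  rw [leibniz_lie, hx, hm h, smul_lie, lie_smul, LinearMap.add_apply, add_smul]

end WeightVectors

/-! ### Finite-dimensional modules over `sl₂` -/

section Sl2

variable {K D M : Type*} [Field K] [CharZero K] [LieRing D] [LieAlgebra K D]
  [AddCommGroup M] [Module K M] [LieRingModule D M] [LieModule K D M] [FiniteDimensional K M]
  {h e f : D}

lemma _root_.IsSl2Triple.exists_nat_of_lie_f_eq_zero (t : IsSl2Triple h e f) {m : M} {μ : K}
    (hm : m ≠ 0) (hh : ⁅h, m⁆ = μ • m) (hf : ⁅f, m⁆ = 0) : ∃ n : ℕ, μ = -n := by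
  have P : t.symm.HasPrimitiveVectorWith m (-μ) := ⟨hm, by rw [neg_lie, hh, neg_smul], hf⟩
  obtain ⟨n, hn⟩ := P.exists_nat
  exact ⟨n, by rw [← hn, neg_neg]⟩

/-- A vector of weight zero killed by `f` is killed by `e`. -/
lemma _root_.IsSl2Triple.lie_e_eq_zero_of_lie_f_eq_zero (t : IsSl2Triple h e f) {m : M}
    (hh : ⁅h, m⁆ = (0 : K) • m) (hf : ⁅f, m⁆ = 0) : ⁅e, m⁆ = 0 := by
  by_cases hm : m = 0
  · simp [hm]
  have P : t.symm.HasPrimitiveVectorWith m (0 : K) := ⟨hm, by simp [hh], hf⟩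
  simpa using P.pow_toEnd_f_eq_zero_of_eq_nat (n := 0) (by simp)

/-- The vectors `e ^ k m` have distinct `h`-eigenvalues `μ + 2k`, so only finitely many can be
nonzero. This produces a primitive vector above any weight vector. -/
lemma _root_.IsSl2Triple.exists_pow_toEnd_e_eq_zero (t : IsSl2Triple h e f) {m : M} {μ : K}
    (hm : m ≠ 0) (hh : ⁅h, m⁆ = μ • m) :
    ∃ k : ℕ, (LieModule.toEnd K D M e ^ k) m ≠ 0 ∧ (LieModule.toEnd K D M e ^ (k + 1)) m = 0 := by
  suffices ∃ k : ℕ, (LieModule.toEnd K D M e ^ k) m = 0 from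
    Nat.exists_not_and_succ_of_not_zero_of_exists (p := fun k ↦ (LieModule.toEnd K D M e ^ k) m = 0)
      (by simpa using hm) this
  by_contra! contra
  have hinj : Function.Injective fun n : ℕ ↦ μ + 2 * (n : K) := fun a b hab ↦ by simpa using hab
  have aux (ν : Set.range fun n : ℕ ↦ μ + 2 * (n : K)) :
      (LieModule.toEnd K D M h).HasEigenvector ν
        ((LieModule.toEnd K D M e ^ ν.property.choose) m) := by
    refine ⟨?_, contra _⟩
    rw [Module.End.mem_eigenspace_iff, LieModule.toEnd_apply_apply]
    nth_rw 2 [← ν.property.choose_spec]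
    exact t.lie_h_pow_toEnd_e hh _
  have _i := ((LieModule.toEnd K D M h).eigenvectors_linearIndependent _ _ aux).finite
  exact Set.infinite_range_of_injective hinj (Set.toFinite _)

end Sl2

/-! ### Modules over a Killing Lie algebra: highest weights and reflections of weights -/

section Killing

variable {K D : Type*} [Field K] [CharZero K] [LieRing D] [LieAlgebra K D] [FiniteDimensional K D]
  [IsKilling K D] {H : LieSubalgebra K D} [H.IsCartanSubalgebra] [LieModule.IsTriangularizable K H D]
  {M : Type*} [AddCommGroup M] [Module K M] [LieRingModule D M] [LieModule K D M]

lemma lie_mem_wt (α : H.root) {x : D} (hx : x ∈ rootSpace H α.1) {χ : Dual K H} {m : M}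
    (hm : m ∈ wt H M χ) : ⁅x, m⁆ ∈ wt H M (χ + α.1.toLinear) := by
  rw [add_comm]
  exact lie_mem_wt_of_forall_lie_eq hm fun h ↦ lie_eq_smul_of_mem_rootSpace hx h

lemma coe_reflectionPerm_self (α : H.root) :
    ((rootSystem H).reflectionPerm α α).1 = -α.1 := by
  have h : (rootSystem H).root ((rootSystem H).reflectionPerm α α) = -(rootSystem H).root α := by
    rw [RootPairing.root_reflectionPerm, RootPairing.reflection_apply_self]
  ext x
  exact LinearMap.congr_fun h x

lemma toLinear_reflectionPerm_self (α : H.root) :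
    ((rootSystem H).reflectionPerm α α).1.toLinear = -α.1.toLinear := by
  rw [coe_reflectionPerm_self]; rfl

lemma exists_sl2Triple (α : H.root) : ∃ e f : D, IsSl2Triple (coroot α.1 : D) e f ∧
    e ∈ rootSpace H α.1 ∧ f ∈ rootSpace H ((rootSystem H).reflectionPerm α α).1 := by
  have hα := H.isNonZero_coe_root α
  obtain ⟨h, e, f, t, he, hf⟩ := exists_isSl2Triple_of_weight_isNonZero hα
  obtain rfl := t.h_eq_coroot hα he hf
  refine ⟨e, f, t, he, ?_⟩
  rwa [coe_reflectionPerm_self]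

lemma exists_smul_eq_of_mem_rootSpace (α : H.root) {e x : D} (he : e ∈ rootSpace H α.1)
    (he0 : e ≠ 0) (hx : x ∈ rootSpace H α.1) : ∃ c : K, c • e = x := by
  have h := finrank_rootSpace_eq_one α.1 (H.isNonZero_coe_root α)
  obtain ⟨c, hc⟩ := (finrank_eq_one_iff_of_nonzero' (⟨e, he⟩ : rootSpace H α.1)
    (by simpa using he0)).mp h ⟨x, hx⟩
  exact ⟨c, congrArg Subtype.val hc⟩

/-- A subspace of a Lie algebra containing a Cartan subalgebra and all root spaces is everything. -/
lemma eq_top_of_cartan_le_of_rootSpace_le (N : Submodule K D) (h0 : H.toSubmodule ≤ N)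
    (h : ∀ α : H.root, (rootSpace H α.1).toSubmodule ≤ N) : N = ⊤ := by
  have key := congrArg LieSubmodule.toSubmodule
    (LieAlgebra.cartan_sup_iSup_rootSpace_eq_top (K := K) (L := D) (H := H))
  rw [LieSubmodule.sup_toSubmodule, LieSubmodule.iSup_toSubmodule,
    LieSubmodule.top_toSubmodule] at key
  refine eq_top_iff.mpr (key ▸ sup_le h0 (iSup_le fun α ↦ ?_))
  rw [LieSubmodule.iSup_toSubmodule]
  exact iSup_le fun hα ↦ h ⟨α, by simpa using hα⟩

/-- A subspace stable under the Cartan subalgebra and all root spaces is stable. -/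
lemma lie_mem_of_cartan_of_rootSpace {N N' : Submodule K M}
    (h0 : ∀ h : H, ∀ m ∈ N, ⁅(h : D), m⁆ ∈ N')
    (h : ∀ α : H.root, ∀ x ∈ rootSpace H α.1, ∀ m ∈ N, ⁅x, m⁆ ∈ N') (x : D) {m : M} (hm : m ∈ N) :
    ⁅x, m⁆ ∈ N' := by
  have := eq_top_of_cartan_le_of_rootSpace_le (H := H)
    (N'.comap ((LieModule.toEnd K D M : D →ₗ[K] Module.End K M).flip m))
    (fun y hy ↦ h0 ⟨y, hy⟩ m hm) (fun α y hy ↦ h α y hy m hm)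
  exact (this ▸ Submodule.mem_top : x ∈ N'.comap _)

lemma eq_top_of_stable [LieModule.IsIrreducible K D M] {N : Submodule K M} (hN : N ≠ ⊥)
    (h0 : ∀ h : H, ∀ m ∈ N, ⁅(h : D), m⁆ ∈ N)
    (h : ∀ α : H.root, ∀ x ∈ rootSpace H α.1, ∀ m ∈ N, ⁅x, m⁆ ∈ N) : N = ⊤ := by
  let N' : LieSubmodule K D M :=
    { N with lie_mem := fun {x m} hm ↦ lie_mem_of_cartan_of_rootSpace h0 h x hm }
  have : N' ≠ ⊥ := fun hc ↦ hN (by simpa [N'] using congrArg LieSubmodule.toSubmodule hc)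
  simpa [N'] using congrArg LieSubmodule.toSubmodule ((eq_bot_or_eq_top N').resolve_left this)

lemma toEnd_pow_mem_wt (α : H.root) {x : D} (hx : x ∈ rootSpace H α.1) {χ : Dual K H} {m : M}
    (hm : m ∈ wt H M χ) (k : ℕ) :
    (LieModule.toEnd K D M x ^ k) m ∈ wt H M (χ + k • α.1.toLinear) := by
  induction k with
  | zero => simpa using hm
  | succ k ih =>
    rw [pow_succ', Module.End.mul_apply, succ_nsmul, ← add_assoc]
    exact lie_mem_wt α hx ih

/-- The sums of at most `n` successive lowerings of `v` by negative root vectors. -/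
def lowering (H : LieSubalgebra K D) [H.IsCartanSubalgebra] [LieModule.IsTriangularizable K H D]
    (S : Set H.root) (v : M) : ℕ → Submodule K M
  | 0 => K ∙ v
  | n + 1 => lowering H S v n ⊔
      Submodule.span K {w | ∃ α ∈ S, ∃ x ∈ rootSpace H ((rootSystem H).reflectionPerm α α).1,
        ∃ m ∈ lowering H S v n, ⁅x, m⁆ = w}

/-- In an irreducible module generated by a vector of weight `χ` killed by the positive root
vectors, every weight takes on a positive element `z` a value below that of `χ`. -/
lemma iSup_wt_eq_top_of_highest [LieModule.IsIrreducible K D M] {S : Set H.root}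
    (hS : ∀ α, α ∈ S ∨ (rootSystem H).reflectionPerm α α ∈ S)
    {z : H} (hz : ∀ α ∈ S, ∃ k : ℕ, α.1 z = k)
    {v : M} (hv0 : v ≠ 0) {χ : Dual K H} (hv : v ∈ wt H M χ)
    (hvS : ∀ α ∈ S, ∀ x ∈ rootSpace H α.1, ⁅x, v⁆ = 0) :
    ⨆ μ ∈ {μ : Dual K H | ∃ k : ℕ, μ z = χ z - k}, wt H M μ = ⊤ := by
  set N := lowering H S v
  have hmono (n : ℕ) : N n ≤ N (n + 1) := le_sup_left
  have hlow (n : ℕ) : ∀ α ∈ S, ∀ x ∈ rootSpace H ((rootSystem H).reflectionPerm α α).1,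
      ∀ m ∈ N n, ⁅x, m⁆ ∈ N (n + 1) := fun α hα x hx m hm ↦
    Submodule.mem_sup_right (Submodule.subset_span ⟨α, hα, x, hx, m, hm, rfl⟩)
  have hstep (n : ℕ) (h0 : ∀ h : H, ∀ m ∈ N n, ⁅(h : D), m⁆ ∈ N n)
      (hp : ∀ α ∈ S, ∀ x ∈ rootSpace H α.1, ∀ m ∈ N n, ⁅x, m⁆ ∈ N n) (x : D) (m : M)
      (hm : m ∈ N n) : ⁅x, m⁆ ∈ N (n + 1) := by
    refine lie_mem_of_cartan_of_rootSpace (fun h m hm ↦ hmono n (h0 h m hm))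
      (fun α x hx m hm ↦ ?_) x hm
    rcases hS α with hα | hα
    · exact hmono n (hp α hα x hx m hm)
    · refine hlow n _ hα x ?_ m hm
      rw [coe_reflectionPerm_self, coe_reflectionPerm_self, neg_neg]
      exact hx
  have hN (n : ℕ) : (∀ h : H, ∀ m ∈ N n, ⁅(h : D), m⁆ ∈ N n) ∧
      (∀ α ∈ S, ∀ x ∈ rootSpace H α.1, ∀ m ∈ N n, ⁅x, m⁆ ∈ N n) ∧
      N n ≤ ⨆ μ ∈ {μ : Dual K H | ∃ k : ℕ, μ z = χ z - k}, wt H M μ := by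
    induction n with
    | zero =>
      refine ⟨fun h m hm ↦ ?_, fun α hα x hx m hm ↦ ?_, ?_⟩
      · obtain ⟨c, rfl⟩ := Submodule.mem_span_singleton.mp hm
        rw [lie_smul, hv h]
        exact Submodule.smul_mem _ _ (Submodule.smul_mem _ _ (Submodule.mem_span_singleton_self v))
      · obtain ⟨c, rfl⟩ := Submodule.mem_span_singleton.mp hm
        rw [lie_smul, hvS α hα x hx, smul_zero]
        exact Submodule.zero_mem _
      · refine (Submodule.span_singleton_le_iff_mem _ _).mpr ?_
        exact Submodule.mem_iSup_of_mem χ (Submodule.mem_iSup_of_mem ⟨0, by simp⟩ hv)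
    | succ n ih =>
      obtain ⟨ih0, ihp, ihle⟩ := ih
      -- In `y(xw) = [y,x]w + x(yw)` the element `[y,x]` of `D` may be arbitrary, since all of `D`
      -- maps `N n` into `N (n + 1)`.
      have key {y : D} (hy : ∀ m ∈ N n, ⁅y, m⁆ ∈ N n) : ∀ m ∈ N (n + 1), ⁅y, m⁆ ∈ N (n + 1) := by
        intro m hm
        refine (show N (n + 1) ≤ (N (n + 1)).comap (LieModule.toEnd K D M y) from
          sup_le (fun w hw ↦ hmono n (hy w hw)) (Submodule.span_le.mpr ?_)) hm
        rintro _ ⟨α, hα, x, hx, w, hw, rfl⟩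
        change ⁅y, ⁅x, w⁆⁆ ∈ N (n + 1)
        rw [leibniz_lie]
        exact add_mem (hstep n ih0 ihp _ w hw) (hlow n α hα x hx _ (hy w hw))
      refine ⟨fun h ↦ key (ih0 h), fun α hα x hx ↦ key (ihp α hα x hx), sup_le ihle ?_⟩
      refine Submodule.span_le.mpr ?_
      rintro _ ⟨α, hα, x, hx, w, hw, rfl⟩
      obtain ⟨f, hf, rfl⟩ := exists_components_of_mem_biSup (ihle hw)
      rw [lie_sum]
      refine Submodule.sum_mem _ fun μ hμ ↦ ?_
      obtain ⟨⟨k, hk⟩, hfμ⟩ := hf μ hμ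
      obtain ⟨l, hl⟩ := hz α hα
      refine Submodule.mem_iSup_of_mem _ (Submodule.mem_iSup_of_mem ?_ (lie_mem_wt _ hx hfμ))
      refine ⟨k + l, ?_⟩
      rw [toLinear_reflectionPerm_self, LinearMap.add_apply, LinearMap.neg_apply, hk,
        LieModule.Weight.toLinear_apply, hl]
      push_cast
      ring
  have hdir : Directed (· ≤ ·) N := (monotone_nat_of_le_succ hmono).directed_le
  have htop : ⨆ n, N n = ⊤ := by
    refine eq_top_of_stable (H := H) (fun hb ↦ hv0 ?_) (fun h m hm ↦ ?_) fun α x hx m hm ↦ ?_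
    · exact (Submodule.eq_bot_iff _).mp hb v
        (Submodule.mem_iSup_of_mem 0 (Submodule.mem_span_singleton_self v))
    all_goals
      obtain ⟨n, hn⟩ := (Submodule.mem_iSup_of_directed _ hdir).mp hm
      exact Submodule.mem_iSup_of_mem (n + 1) (hstep n (hN n).1 (hN n).2.1 _ m hn)
  exact eq_top_iff.mpr (htop ▸ iSup_le fun n ↦ (hN n).2.2)

/-- The weights of an irreducible module generated by a highest weight vector. -/
lemma exists_nat_apply_eq_of_highest [LieModule.IsIrreducible K D M] {S : Set H.root}
    (hS : ∀ α, α ∈ S ∨ (rootSystem H).reflectionPerm α α ∈ S)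
    {z : H} (hz : ∀ α ∈ S, ∃ k : ℕ, α.1 z = k)
    {v : M} (hv0 : v ≠ 0) {χ : Dual K H} (hv : v ∈ wt H M χ)
    (hvS : ∀ α ∈ S, ∀ x ∈ rootSpace H α.1, ⁅x, v⁆ = 0) {μ : Dual K H} (hμ : wt H M μ ≠ ⊥) :
    ∃ k : ℕ, μ z = χ z - k := by
  obtain ⟨m, hm, hm0⟩ := Submodule.exists_mem_ne_zero_of_ne_bot hμ
  exact mem_of_mem_wt_of_mem_biSup (fun _ ↦ le_rfl) hm0 hm
    (iSup_wt_eq_top_of_highest hS hz hv0 hv hvS ▸ Submodule.mem_top)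

variable [FiniteDimensional K M]

/-- If `e ^ k m` is primitive of weight `N`, then `n = N - 2k`. The vector `f ^ (N - k) (e ^ k m)`
has weight `χ - nα`, and it is nonzero as soon as `0 ≤ N - k = n + k`. -/
lemma exists_int_apply_coroot (α : H.root) {χ : Dual K H} (hχ : wt H M χ ≠ ⊥) :
    ∃ n k : ℤ, χ (coroot α.1) = n ∧ 0 ≤ k ∧ 0 ≤ n + 2 * k ∧
      (0 ≤ n + k → wt H M (χ - n • α.1.toLinear) ≠ ⊥) := by
  obtain ⟨m, hm, hm0⟩ := Submodule.exists_mem_ne_zero_of_ne_bot hχ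
  obtain ⟨e, f, t, he, hf⟩ := exists_sl2Triple α
  obtain ⟨k, hk0, hk1⟩ := t.exists_pow_toEnd_e_eq_zero hm0 (hm (coroot α.1))
  have hu := toEnd_pow_mem_wt α he hm k
  have P : t.HasPrimitiveVectorWith ((LieModule.toEnd K D M e ^ k) m)
      (χ (coroot α.1) + 2 * k) := by
    refine ⟨hk0, t.lie_h_pow_toEnd_e (hm (coroot α.1)) k, ?_⟩
    rwa [IsSl2Triple.lie_e_pow_toEnd_e]
  obtain ⟨N, hN⟩ := P.exists_nat
  refine ⟨N - 2 * k, k, by push_cast; rw [← hN]; ring, by positivity, by lia, fun h ↦ ?_⟩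
  obtain ⟨j, hj⟩ : ∃ j : ℕ, (j : ℤ) = N - k := ⟨(N - k : ℤ).toNat, by lia⟩
  have h1 := P.pow_toEnd_f_ne_zero_of_eq_nat hN (i := j) (by lia)
  have h2 := toEnd_pow_mem_wt _ hf hu j
  rw [toLinear_reflectionPerm_self] at h2
  refine fun hb ↦ h1 ((Submodule.eq_bot_iff _).mp hb _ ?_)
  convert h2 using 2
  rw [← natCast_zsmul, ← natCast_zsmul, hj]
  module

/-- The weights of a finite-dimensional module are stable under reflections. -/
lemma wt_sub_ne_bot (α : H.root) {χ : Dual K H} (hχ : wt H M χ ≠ ⊥) {n : ℤ}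
    (hn : χ (coroot α.1) = n) : wt H M (χ - n • α.1.toLinear) ≠ ⊥ := by
  obtain ⟨n₁, k, h1, hk, h2, h3⟩ := exists_int_apply_coroot α hχ
  obtain rfl : n = n₁ := by exact_mod_cast hn.symm.trans h1
  rcases le_total 0 n with h | h
  · exact h3 (by lia)
  -- For `n ≤ 0` use `-α`: both `n` and `α` change sign, so `χ - nα` is unchanged.
  obtain ⟨n₂, k', h1', hk', h2', h3'⟩ :=
    exists_int_apply_coroot ((rootSystem H).reflectionPerm α α) hχ
  rw [coe_reflectionPerm_self, coroot_neg, map_neg, hn] at h1'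
  obtain rfl : -n = n₂ := by exact_mod_cast h1'
  convert h3' (by lia) using 2
  rw [toLinear_reflectionPerm_self]
  module

end Killing

/-! ### Long and short roots, and sums of roots versus sums of coroots -/

section Combinatorics

variable {ι K M N : Type*} [Fintype ι] [Field K] [CharZero K] [AddCommGroup M] [Module K M]
  [AddCommGroup N] [Module K N] {P : RootPairing ι K M N} [P.IsCrystallographic]

lemma sqLength_pos (i : ι) : 0 < sqLength P i := (P.posRootForm ℤ).rootLength_pos i

lemma pairingIn_mul_sqLength (i j : ι) :
    P.pairingIn ℤ j i * sqLength P i = P.pairingIn ℤ i j * sqLength P j :=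
  (P.posRootForm ℤ).pairingIn_mul_eq_pairingIn_mul_swap i j

lemma cast_sqLength (i : ι) : (sqLength P i : K) = P.RootForm (P.root i) (P.root i) := by
  simpa using! (P.posRootForm ℤ).algebraMap_rootLength i

lemma sqLength_reflectionPerm (i j : ι) : sqLength P (P.reflectionPerm j i) = sqLength P i := by
  have : ((sqLength P (P.reflectionPerm j i) : ℤ) : K) = sqLength P i := by
    rw [cast_sqLength, cast_sqLength, RootPairing.root_reflectionPerm,
      P.rootForm_reflection_reflection_apply]
  exact_mod_cast this

lemma IsLong.reflectionPerm {i : ι} (h : IsLong P i) (j : ι) : IsLong P (P.reflectionPerm j i) :=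
  fun k ↦ sqLength_reflectionPerm (P := P) i j ▸ h k

lemma root_reflectionPerm_eq (i j : ι) :
    P.root (P.reflectionPerm j i) = P.root i - P.pairingIn ℤ i j • P.root j := by
  rw [RootPairing.root_reflectionPerm, RootPairing.reflection_apply_root' ℤ]

lemma coroot_reflectionPerm_eq (i j : ι) :
    P.coroot (P.reflectionPerm j i) = P.coroot i - P.pairingIn ℤ j i • P.coroot j := by
  rw [RootPairing.coroot_reflectionPerm, RootPairing.coreflection_apply_coroot, 
    ← P.algebraMap_pairingIn ℤ, algebraMap_smul]

lemma pairingIn_reflectionPerm_left (i j l : ι) :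
    P.pairingIn ℤ (P.reflectionPerm j i) l =
      P.pairingIn ℤ i l - P.pairingIn ℤ i j * P.pairingIn ℤ j l := by
  have : P.pairing (P.reflectionPerm j i) l = P.pairing i l - P.pairing i j * P.pairing j l := by
    simp only [← RootPairing.root_coroot_eq_pairing P _ l, root_reflectionPerm_eq, map_sub,
      map_zsmul, LinearMap.sub_apply, LinearMap.smul_apply, zsmul_eq_mul,
      ← eq_intCast (algebraMap ℤ K), P.algebraMap_pairingIn ℤ]
  simp only [← P.algebraMap_pairingIn ℤ] at this
  exact_mod_cast this

lemma pairingIn_reflectionPerm_right (i j l : ι) :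
    P.pairingIn ℤ l (P.reflectionPerm j i) =
      P.pairingIn ℤ l i - P.pairingIn ℤ j i * P.pairingIn ℤ l j := by
  have : P.pairing l (P.reflectionPerm j i) = P.pairing l i - P.pairing j i * P.pairing l j := by
    simp only [← RootPairing.root_coroot_eq_pairing P l, coroot_reflectionPerm_eq, map_sub,
      map_zsmul, zsmul_eq_mul,
      ← eq_intCast (algebraMap ℤ K), P.algebraMap_pairingIn ℤ]
  simp only [← P.algebraMap_pairingIn ℤ] at this
  exact_mod_cast this

lemma pairingIn_of_coroot_add {i j k : ι} (h : P.coroot i + P.coroot j = P.coroot k) (l : ι) :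
    P.pairingIn ℤ l i + P.pairingIn ℤ l j = P.pairingIn ℤ l k := by
  have : P.pairing l i + P.pairing l j = P.pairing l k := by
    simp only [← RootPairing.root_coroot_eq_pairing, ← h, map_add]
  simp only [← P.algebraMap_pairingIn ℤ] at this
  exact_mod_cast this

lemma pairingIn_of_root_add {i j k : ι} (h : P.root i + P.root j = P.root k) (l : ι) :
    P.pairingIn ℤ i l + P.pairingIn ℤ j l = P.pairingIn ℤ k l := by
  have : P.pairing i l + P.pairing j l = P.pairing k l := by
    simp only [← RootPairing.root_coroot_eq_pairing, ← h, map_add, LinearMap.add_apply]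
  simp only [← P.algebraMap_pairingIn ℤ] at this
  exact_mod_cast this

lemma IsLong.pairingIn_comm {i j : ι} (hi : IsLong P i) (hj : IsLong P j) :
    P.pairingIn ℤ i j = P.pairingIn ℤ j i := by
  have h := pairingIn_mul_sqLength (P := P) i j
  rw [le_antisymm (hi j) (hj i)] at h
  exact (mul_right_cancel₀ (sqLength_pos i).ne' h).symm

variable {b : P.Base}

lemma root_reflectionPerm_self (i : ι) : P.root (P.reflectionPerm i i) = -P.root i := by
  rw [RootPairing.root_reflectionPerm, RootPairing.reflection_apply_self]

lemma coroot_reflectionPerm_self (i : ι) : P.coroot (P.reflectionPerm i i) = -P.coroot i := by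
  rw [RootPairing.coroot_reflectionPerm, RootPairing.coreflection_apply_self]

lemma isPos_or_isPos_reflectionPerm_self (i : ι) : b.IsPos i ∨ b.IsPos (P.reflectionPerm i i) :=
  RootPairing.Base.IsPos.or_neg b i

/-- The linear extension of the height of roots. -/
lemma exists_height_linearMap [P.IsRootSystem] (b : P.Base) :
    ∃ f : M →ₗ[K] K, ∀ i, f (P.root i) = b.height i := by
  refine ⟨b.toWeightBasis.constr K fun _ ↦ 1, fun i ↦ ?_⟩
  obtain ⟨f, -, -, hf⟩ := b.exists_root_eq_sum_int i
  rw [RootPairing.Base.height_eq_sum hf, hf, map_sum, Int.cast_sum]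
  refine Finset.sum_congr rfl fun j hj ↦ ?_
  have := b.toWeightBasis.constr_basis K (fun _ ↦ (1 : K)) ⟨j, hj⟩
  rw [RootPairing.Base.toWeightBasis_apply] at this
  rw [map_zsmul, this, zsmul_one]

lemma IsHighestRoot.exists_nat_eq_sub {θ : ι} (hθ : IsHighestRoot b θ) {A : Type*}
    [AddCommGroupWithOne A] (f : M →+ A)
    (hf : ∀ i ∈ b.support, ∃ k : ℕ, f (P.root i) = k) (j : ι) :
    ∃ k : ℕ, f (P.root θ) - f (P.root j) = k := by
  rw [← map_sub]
  have hmem := hθ j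
  generalize P.root θ - P.root j = x at hmem
  induction hmem using AddSubmonoid.closure_induction with
  | mem x hx => obtain ⟨i, hi, rfl⟩ := hx; exact hf i hi
  | zero => exact ⟨0, by simp⟩
  | add x y _ _ hx hy =>
    obtain ⟨k, hk⟩ := hx
    obtain ⟨l, hl⟩ := hy
    exact ⟨k + l, by rw [map_add, hk, hl, Nat.cast_add]⟩

lemma IsHighestRoot.isPos [P.IsRootSystem] {θ : ι} (hθ : IsHighestRoot b θ) : b.IsPos θ := by
  obtain ⟨f, hf⟩ := exists_height_linearMap b
  obtain ⟨k, hk⟩ := hθ.exists_nat_eq_sub f.toAddMonoidHom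
    (fun i hi ↦ ⟨1, by simp [hf, RootPairing.Base.height_one_of_mem_support hi]⟩)
    (P.reflectionPerm θ θ)
  have h1 := RootPairing.Base.height_reflectionPerm_self (b := b) θ
  simp only [RootPairing.indexNeg_neg] at h1
  simp only [LinearMap.toAddMonoidHom_coe, hf, h1] at hk
  have h2 : b.height θ - -b.height θ = k := by exact_mod_cast hk
  have := RootPairing.Base.height_ne_zero (b := b) θ
  rw [RootPairing.Base.isPos_iff]
  lia

variable [P.IsReduced]

/-- A long root `γ` of maximal height is dominant, for otherwise a simple reflection would raise its
height. As `θ - γ` is a sum of simple roots, `⟨θ, γ^∨⟩ ≥ ⟨γ, γ^∨⟩ = 2`, which is impossible if `θ`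
is shorter than `γ`. -/
lemma IsHighestRoot.isLong [P.IsRootSystem] {θ : ι} (hθ : IsHighestRoot b θ) : IsLong P θ := by
  obtain ⟨γ₀, -, h₀⟩ := Finset.exists_max_image Finset.univ (sqLength P) ⟨θ, Finset.mem_univ θ⟩
  have hγ₀ : IsLong P γ₀ := fun j ↦ h₀ j (Finset.mem_univ j)
  classical
  obtain ⟨γ, hγ, hmax⟩ := Finset.exists_max_image (Finset.univ.filter (IsLong P)) b.height
    ⟨γ₀, by simpa using hγ₀⟩
  replace hγ : IsLong P γ := by simpa using hγ
  have hdom : ∀ j ∈ b.support, 0 ≤ P.pairingIn ℤ j γ := by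
    intro j hj
    by_contra! hneg
    have h1 := (P.pairingIn_lt_zero_iff ℤ).mp hneg
    have h2 := RootPairing.Base.height_add_zsmul (b := b) (i := γ) (j := j) (z := -P.pairingIn ℤ γ j)
      (k := P.reflectionPerm j γ) (by rw [root_reflectionPerm_eq]; module)
    have h3 := hmax (P.reflectionPerm j γ) (by simpa using hγ.reflectionPerm j)
    rw [RootPairing.Base.height_one_of_mem_support hj] at h2
    simp at h2
    lia
  obtain ⟨k, hk⟩ := hθ.exists_nat_eq_sub (P.coroot' γ).toAddMonoidHom (fun i hi ↦
    ⟨(P.pairingIn ℤ i γ).toNat, by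
      have := Int.toNat_of_nonneg (hdom i hi)
      rw [← Int.cast_natCast, this]
      simpa using (P.algebraMap_pairingIn ℤ i γ).symm⟩) γ
  have h2 : 2 ≤ P.pairingIn ℤ θ γ := by
    have : (P.pairingIn ℤ θ γ : K) - 2 = k := by
      rw [← hk, ← eq_intCast (algebraMap ℤ K), P.algebraMap_pairingIn ℤ]
      simp
    have : P.pairingIn ℤ θ γ - 2 = k := by exact_mod_cast this
    lia
  have h3 := P.pairingIn_pairingIn_mem_set_of_isCrystal_of_isRed θ γ
  have h4 := pairingIn_mul_sqLength (P := P) θ γ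
  have h5 := sqLength_pos (P := P) θ
  have h6 := sqLength_pos (P := P) γ
  intro j
  refine (hγ j).trans ?_
  simp only [Set.mem_insert_iff, Set.mem_singleton_iff, Prod.mk.injEq] at h3
  rcases h3 with h | h | h | h | h | h | h | h | h | h | h | h | h <;> 
    simp only [h] at h2 h4 <;> lia

/-- The squared length of the long roots is twice that of the other roots. -/
def IsDoublyLaced (P : RootPairing ι K M N) [P.IsCrystallographic] : Prop :=
  ∀ i j, IsLong P i → ¬ IsLong P j → sqLength P i = 2 * sqLength P j

/-- An irreducible root system has at most two root lengths, so those of `θ` and `θs` are all of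
them. -/
lemma isDoublyLaced_of_sqLength_eq [P.IsIrreducible] {θ θs : ι} (hθ : IsLong P θ)
    (h : sqLength P θ = 2 * sqLength P θs) : IsDoublyLaced P := by
  intro i j hi hj
  have hpos := sqLength_pos (P := P) θs
  have key : sqLength P j = sqLength P θ ∨ sqLength P j = sqLength P θs := by
    have := (P.posRootForm ℤ).toInvariantForm.apply_eq_or_of_apply_ne (i := θ) (j := θs) (by
      change P.RootForm _ _ ≠ P.RootForm _ _
      rw [← cast_sqLength, ← cast_sqLength, Ne, Int.cast_inj]
      lia) j
    change P.RootForm _ _ = P.RootForm _ _ ∨ P.RootForm _ _ = P.RootForm _ _ at this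
    simpa only [← cast_sqLength, Int.cast_inj] using this
  rcases key with hk | hk
  · exact absurd (fun l ↦ hk ▸ hθ l) hj
  · rw [hk, ← h]
    exact le_antisymm (hθ i) (hi θ)

lemma IsDoublyLaced.pairingIn_eq (hP : IsDoublyLaced P) {i j : ι} (hi : IsLong P i)
    (hj : ¬ IsLong P j) : P.pairingIn ℤ i j = 2 * P.pairingIn ℤ j i := by
  have h := pairingIn_mul_sqLength (P := P) i j
  rw [hP i j hi hj] at h
  have := (sqLength_pos (P := P) j).ne'
  apply mul_right_cancel₀ this
  linear_combination -h

lemma isLong_reflectionPerm_iff {i j : ι} : IsLong P (P.reflectionPerm j i) ↔ IsLong P i :=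
  ⟨fun h ↦ by simpa using h.reflectionPerm j, fun h ↦ h.reflectionPerm j⟩

lemma pairingIn_cases_of_eq {i j : ι} (h : P.pairingIn ℤ i j = P.pairingIn ℤ j i) :
    j = i ∨ j = P.reflectionPerm i i ∨ P.pairingIn ℤ i j = 0 ∨ P.pairingIn ℤ i j = 1 ∨
      P.pairingIn ℤ i j = -1 := by
  by_cases h1 : j = i
  · exact .inl h1
  by_cases h2 : P.root i = -P.root j
  · exact .inr (.inl (P.root.injective (by rw [root_reflectionPerm_self, h2, neg_neg])))
  have h3 := P.pairingIn_pairingIn_mem_set_of_isCrystal_of_isRed' i j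
    (fun e ↦ h1 (P.root.injective e).symm) h2
  simp only [Set.mem_insert_iff, Set.mem_singleton_iff, Prod.mk.injEq] at h3
  lia

/-- The span of the roots satisfying `A` is nonzero and invariant under all reflections, hence the
whole space, and so not contained in the kernel of the coroot of `i`. -/
lemma exists_pairingIn_ne_zero_of_stable [P.IsIrreducible] {A : ι → Prop}
    (hA : ∀ i, A i → ∀ j, A (P.reflectionPerm j i)) {θ : ι} (h : A θ) (i : ι) :
    ∃ k, A k ∧ P.pairingIn ℤ k i ≠ 0 := by
  set q : Submodule K M := Submodule.span K (P.root '' {k | A k})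
  have hq : q = ⊤ := by
    refine RootPairing.IsIrreducible.eq_top_of_invtSubmodule_reflection (P := P) q (fun j ↦ ?_) ?_
    · rw [Module.End.mem_invtSubmodule, Submodule.span_le]
      rintro _ ⟨k, hk, rfl⟩
      refine Submodule.subset_span ⟨P.reflectionPerm j k, hA k hk j, ?_⟩
      rw [RootPairing.root_reflectionPerm]; rfl
    · intro hb
      have : P.root θ ∈ q := Submodule.subset_span ⟨θ, h, rfl⟩
      rw [hb, Submodule.mem_bot] at this
      exact P.ne_zero θ this
  by_contra! hc
  have : q ≤ LinearMap.ker (P.coroot' i) := by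
    refine Submodule.span_le.mpr ?_
    rintro _ ⟨k, hk, rfl⟩
    have := hc k hk
    rw [← (FaithfulSMul.algebraMap_injective ℤ K).eq_iff, P.algebraMap_pairingIn ℤ] at this
    simpa using this
  have := this (hq ▸ Submodule.mem_top : P.root i ∈ q)
  simp at this

/-- A property stable under reflections which holds for one long root holds for all. -/
lemma forall_isLong_of_stable [P.IsIrreducible] {A : ι → Prop}
    (hA : ∀ i, A i → ∀ j, A (P.reflectionPerm j i)) {θ : ι} (hθ : IsLong P θ) (h : A θ) :
    ∀ i, IsLong P i → A i := by
  intro i hi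
  obtain ⟨k, ⟨hk, hk'⟩, hki⟩ := exists_pairingIn_ne_zero_of_stable (A := fun k ↦ A k ∧ IsLong P k)
    (fun k hk j ↦ ⟨hA k hk.1 j, hk.2.reflectionPerm j⟩) ⟨h, hθ⟩ i
  have hc := hk'.pairingIn_comm hi
  have hr : P.root (P.reflectionPerm k (P.reflectionPerm i k)) =
      -P.root k - P.pairingIn ℤ k i • (P.root i - P.pairingIn ℤ i k • P.root k) := by
    rw [RootPairing.root_reflectionPerm, root_reflectionPerm_eq, map_sub, map_zsmul,
      RootPairing.reflection_apply_self, RootPairing.reflection_apply_root' ℤ]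
  rcases pairingIn_cases_of_eq hc with rfl | rfl | h0 | h1 | h1
  · exact hk
  · exact hA k hk k
  · exact absurd h0 hki
  -- Long roots with pairing `-1` satisfy `i = s_k s_i k`; with pairing `1` this product gives `-i`,
  -- and one more `s_i` corrects the sign.
  · have : i = P.reflectionPerm i (P.reflectionPerm k (P.reflectionPerm i k)) :=
      P.root.injective (by
        rw [RootPairing.root_reflectionPerm, hr, ← hc, h1]
        simp only [one_smul, map_sub, map_neg, RootPairing.reflection_apply_self]
        module)
    exact this ▸ hA _ (hA _ (hA k hk i) k) i
  · have : i = P.reflectionPerm k (P.reflectionPerm i k) :=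
      P.root.injective (by rw [hr, ← hc, h1]; module)
    exact this ▸ hA _ (hA k hk i) k

/-- Every root which is not long pairs to `2` with some long root. -/
lemma IsDoublyLaced.exists_pairingIn_eq [P.IsIrreducible] (hP : IsDoublyLaced P) {θ j : ι}
    (hθ : IsLong P θ) (hj : ¬ IsLong P j) :
    ∃ i, IsLong P i ∧ P.pairingIn ℤ i j = 2 ∧ P.pairingIn ℤ j i = 1 := by
  obtain ⟨k, hk, hkj⟩ := exists_pairingIn_ne_zero_of_stable (A := IsLong P)
    (fun k hk j ↦ hk.reflectionPerm j) hθ j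
  have h1 := hP.pairingIn_eq hk hj
  have h2 := P.pairingIn_pairingIn_mem_set_of_isCrystal_of_isRed k j
  simp only [Set.mem_insert_iff, Set.mem_singleton_iff, Prod.mk.injEq] at h2
  have h3 : P.pairingIn ℤ j k = 1 ∨ P.pairingIn ℤ j k = -1 := by lia
  rcases h3 with h3 | h3
  · exact ⟨k, hk, by lia, h3⟩
  · refine ⟨P.reflectionPerm k k, hk.reflectionPerm k, ?_, ?_⟩ <;> simp [h3, h1]

lemma IsDoublyLaced.eq_reflectionPerm_self_of_pairingIn_neg (hP : IsDoublyLaced P) {i j : ι}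
    (hi : IsLong P i) (h : P.pairingIn ℤ j i < 0) (h' : P.pairingIn ℤ j i ≠ -1) :
    j = P.reflectionPerm i i := by
  have h2 := P.pairingIn_pairingIn_mem_set_of_isCrystal_of_isRed i j
  simp only [Set.mem_insert_iff, Set.mem_singleton_iff, Prod.mk.injEq] at h2
  by_cases hj : IsLong P j
  · rcases pairingIn_cases_of_eq (hi.pairingIn_comm hj) with rfl | h0 | h0 | h0 | h0
    · simp at h
    · exact h0
    all_goals have := hi.pairingIn_comm hj; lia
  · have := hP.pairingIn_eq hi hj
    lia

/-- Two long roots the sum of whose coroots is a coroot. -/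
lemma IsDoublyLaced.root_of_coroot_add (hP : IsDoublyLaced P) {i j k : ι} (hi : IsLong P i)
    (hj : IsLong P j) (h : P.coroot i + P.coroot j = P.coroot k) :
    (IsLong P k ∧ P.root k = P.root i + P.root j) ∨ (¬ IsLong P k ∧ ∃ l,
      P.root k = P.root i + P.root l ∧ P.root k = P.root j + P.root (P.reflectionPerm l l)) := by
  have h1 := pairingIn_of_coroot_add h i
  have h2 := pairingIn_of_coroot_add h j
  have h3 := pairingIn_of_coroot_add h k
  have h4 := hi.pairingIn_comm hj
  simp only [RootPairing.pairingIn_same] at h1 h2 h3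
  by_cases hk : IsLong P k
  · have h5 := hi.pairingIn_comm hk
    have h6 := hj.pairingIn_comm hk
    have h7 : P.pairingIn ℤ j i = -1 := by lia
    have h8 : k = P.reflectionPerm j i := P.coroot.injective (by
      rw [coroot_reflectionPerm_eq, h7, ← h]; module)
    refine .inl ⟨hk, ?_⟩
    rw [h8, root_reflectionPerm_eq, h4, h7]
    module
  · have h5 := hP.pairingIn_eq hi hk
    have h6 := hP.pairingIn_eq hj hk
    have h7 : P.pairingIn ℤ k i = 1 := by lia
    have h8 : P.pairingIn ℤ k j = 1 := by lia
    have h9 : P.pairingIn ℤ i k = 2 := by lia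
    have h10 : P.pairingIn ℤ j k = 2 := by lia
    have h11 : P.reflectionPerm (P.reflectionPerm i k) (P.reflectionPerm i k) =
        P.reflectionPerm j k := P.coroot.injective (by
      rw [coroot_reflectionPerm_self, coroot_reflectionPerm_eq, coroot_reflectionPerm_eq, h9, h10,
        ← h]
      module)
    -- In `B₂`: `i = ε₁ + ε₂`, `j = ε₁ - ε₂`, `k = ε₁`, and `l = k - i = -ε₂ = -(k - j)`.
    refine .inr ⟨hk, P.reflectionPerm i k, ?_, ?_⟩
    · rw [root_reflectionPerm_eq, h7]; module
    · rw [h11, root_reflectionPerm_eq, h8]; module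

/-- Long roots whose coroots differ by a coroot. -/
lemma IsDoublyLaced.root_of_coroot_sub (hP : IsDoublyLaced P) {i j k : ι} (hi : IsLong P i)
    (hk : IsLong P k) (h : P.coroot i + P.coroot j = P.coroot k) :
    P.root k = P.root i + P.root j ∨ ∃ l, ¬ IsLong P l ∧ P.root l = P.root i + P.root j := by
  by_cases hj : IsLong P j
  · rcases hP.root_of_coroot_add hi hj h with h' | h'
    · exact .inl h'.2
    · exact absurd hk h'.1
  · have h1 := pairingIn_of_coroot_add h i
    have h2 := pairingIn_of_coroot_add h j
    have h3 := pairingIn_of_coroot_add h k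
    have h4 := hi.pairingIn_comm hk
    simp only [RootPairing.pairingIn_same] at h1 h2 h3
    have h5 := hP.pairingIn_eq hi hj
    have h6 := hP.pairingIn_eq hk hj
    have h7 : P.pairingIn ℤ j i = -1 := by lia
    refine .inr ⟨P.reflectionPerm i j, by rwa [isLong_reflectionPerm_iff], ?_⟩
    rw [root_reflectionPerm_eq, h7]
    module

/-- A short `k` would make both `⟨i, k^∨⟩` and `⟨j, k^∨⟩` even, which is incompatible with the
pairings of `k = i + j`. So `k` is long and equals `s_j i`. -/
lemma IsDoublyLaced.coroot_of_root_add (hP : IsDoublyLaced P) {i j k : ι} (hi : IsLong P i)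
    (hj : IsLong P j) (h : P.root i + P.root j = P.root k) :
    IsLong P k ∧ P.coroot i + P.coroot j = P.coroot k ∧ P.pairingIn ℤ j i = -1 ∧
      P.pairingIn ℤ i k = 1 := by
  have h1 := pairingIn_of_root_add h i
  have h2 := pairingIn_of_root_add h j
  have h3 := pairingIn_of_root_add h k
  have h4 := hi.pairingIn_comm hj
  simp only [RootPairing.pairingIn_same] at h1 h2 h3
  by_cases hk : IsLong P k
  · have h5 := hi.pairingIn_comm hk
    have h6 := hj.pairingIn_comm hk
    have h7 : P.pairingIn ℤ j i = -1 := by lia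
    have h8 : k = P.reflectionPerm j i := P.root.injective (by
      rw [root_reflectionPerm_eq, h4, h7, ← h]; module)
    refine ⟨hk, ?_, h7, by lia⟩
    rw [h8, coroot_reflectionPerm_eq, h7]
    module
  · have h5 := hP.pairingIn_eq hi hk
    have h6 := hP.pairingIn_eq hj hk
    lia

/-- In `B₂`: `i = ε₁ - ε₂`, `j = ε₂`, `k = ε₁` and `l = i + 2j = ε₁ + ε₂`. Stability under `j` leads
from `i` to `l`, and the odd vectors for `i` and `l` bracket into the root space of `k^∨`. -/
lemma IsDoublyLaced.exists_of_root_add (hP : IsDoublyLaced P) {i j k : ι} (hi : IsLong P i)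
    (hj : ¬ IsLong P j) (h : P.root i + P.root j = P.root k) :
    P.pairingIn ℤ j i = -1 ∧ P.pairingIn ℤ i k = 2 ∧ ∃ l, IsLong P l ∧
      P.root l = P.root k + P.root j ∧ P.coroot i + P.coroot j = P.coroot l ∧
      P.coroot i + P.coroot l = P.coroot k := by
  have h1 := pairingIn_of_root_add h i
  have h2 := pairingIn_of_root_add h j
  have h3 := pairingIn_of_root_add h k
  have h4 := hP.pairingIn_eq hi hj
  simp only [RootPairing.pairingIn_same] at h1 h2 h3
  by_cases hk : IsLong P k
  · have h5 := hi.pairingIn_comm hk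
    have h6 := hP.pairingIn_eq hk hj
    lia
  · have h5 := hP.pairingIn_eq hi hk
    have h6 : P.pairingIn ℤ j k = P.pairingIn ℤ k j := by
      have h8 := pairingIn_mul_sqLength (P := P) j k
      have h9 := hP i j hi hj
      have h10 := hP i k hi hk
      rw [show sqLength P k = sqLength P j by lia] at h8
      exact (mul_right_cancel₀ (sqLength_pos j).ne' h8).symm
    have h7 : P.pairingIn ℤ j i = -1 := by lia
    have h8 : P.pairingIn ℤ i j = -2 := by lia
    have h9 : k = P.reflectionPerm i j := P.root.injective (by
      rw [root_reflectionPerm_eq, h7, ← h]; module)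
    refine ⟨h7, by lia, P.reflectionPerm j i, hi.reflectionPerm j, ?_, ?_, ?_⟩
    · rw [root_reflectionPerm_eq, h8, ← h]; module
    · rw [coroot_reflectionPerm_eq, h7]; module
    · rw [h9, coroot_reflectionPerm_eq, coroot_reflectionPerm_eq, h7, h8]; module

/-- A linear form with positive values on the positive coroots. -/
lemma IsDoublyLaced.exists_coweight_pos [P.IsRootSystem] (hP : IsDoublyLaced P) {θ : ι}
    (hθ : IsLong P θ) (b : P.Base) :
    ∃ f : N →ₗ[K] K, ∀ i, b.IsPos i → ∃ k : ℕ, 0 < k ∧ f (P.coroot i) = k := by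
  obtain ⟨f, hf⟩ := exists_height_linearMap b
  -- The height is transported along `α^∨ = 2α/|α|²`. The factor `|θ|²` makes the values integral:
  -- `2 ht α` for `α` long and `4 ht α` for `α` short.
  refine ⟨(sqLength P θ : K) • f ∘ₗ P.PolarizationEquiv.symm.toLinearMap, fun i hi ↦ ?_⟩
  rw [RootPairing.Base.isPos_iff] at hi
  obtain ⟨n, hn⟩ : ∃ n : ℕ, (n : ℤ) = b.height i := ⟨(b.height i).toNat, by lia⟩
  have hi0 : (sqLength P i : K) ≠ 0 := by exact_mod_cast (sqLength_pos i).ne'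
  have hval : ((sqLength P θ : K) • f ∘ₗ P.PolarizationEquiv.symm.toLinearMap) (P.coroot i) =
      (sqLength P θ : K) * (2 / sqLength P i) * n := by
    have := P.polarizationEquiv_symm_apply_coroot (i := i)
    simp only [LinearMap.smul_apply, LinearMap.comp_apply, LinearEquiv.coe_coe, this, map_smul, hf,
      ← hn, ← cast_sqLength, smul_eq_mul, Int.cast_natCast]
    ring
  rw [hval]
  by_cases hl : IsLong P i
  · refine ⟨2 * n, by lia, ?_⟩
    rw [le_antisymm (hθ i) (hl θ)] at *
    push_cast; field_simp
  · refine ⟨4 * n, by lia, ?_⟩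
    rw [hP θ i hθ hl]
    push_cast; field_simp; ring

end Combinatorics

/-! ### Root spaces as weight spaces, and invariance of the Killing form -/

section Adjoint

variable {K D : Type*} [Field K] [CharZero K] [LieRing D] [LieAlgebra K D] [FiniteDimensional K D]
  [IsKilling K D] {H : LieSubalgebra K D} [H.IsCartanSubalgebra] [LieModule.IsTriangularizable K H D]

lemma rootSpace_eq_wt (α : H.root) : (rootSpace H α.1).toSubmodule = wt H D α.1.toLinear := by
  refine le_antisymm (fun x hx h ↦ lie_eq_smul_of_mem_rootSpace hx h) fun x hx ↦ ?_
  exact LieModule.weightSpace_le_genWeightSpace D _ ((LieModule.mem_weightSpace _ x).mpr hx)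

lemma mem_wt_of_mem_rootSpace {α : H.root} {x : D} (hx : x ∈ rootSpace H α.1) :
    x ∈ wt H D α.1.toLinear := (rootSpace_eq_wt α).le hx

lemma mem_cartan_of_mem_wt_zero {x : D} (hx : x ∈ wt H D 0) : x ∈ H := by
  have : x ∈ rootSpace H (0 : H → K) :=
    LieModule.weightSpace_le_genWeightSpace D _ ((LieModule.mem_weightSpace _ x).mpr hx)
  rw [rootSpace_zero_eq] at this
  exact this

lemma exists_root_of_mem_wt {x : D} (hx0 : x ≠ 0) {χ : Dual K H} (hχ : χ ≠ 0)
    (hx : x ∈ wt H D χ) : ∃ α : H.root, α.1.toLinear = χ := by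
  have hx' : x ∈ rootSpace H χ :=
    LieModule.weightSpace_le_genWeightSpace D _ ((LieModule.mem_weightSpace _ x).mpr hx)
  let α : LieModule.Weight K H D := ⟨χ, fun hb ↦ hx0 (by simpa [hb] using hx')⟩
  refine ⟨⟨α, ?_⟩, LinearMap.ext fun h ↦ rfl⟩
  simp only [LieSubalgebra.root, Finset.mem_filter, Finset.mem_univ, true_and]
  exact fun h0 ↦ hχ (LinearMap.ext fun h ↦ congrFun h0 h)

lemma killingForm_lie_left {L : Type*} [LieRing L] [LieAlgebra K L] (x y z : L) :
    killingForm K L ⁅x, y⁆ z = -killingForm K L y ⁅x, z⁆ := by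
  rw [← lie_skew, map_neg, LinearMap.neg_apply, killingForm, LieModule.traceForm_apply_lie_apply]

end Adjoint

/-! ### The odd part of the graded algebra and the Killing form -/

section Graded

variable {K G : Type*} [Field K] [CharZero K] [LieRing G] [LieAlgebra K G] [FiniteDimensional K G]
  {D : LieSubalgebra K G} {H : LieSubalgebra K D} {V : LieSubmodule K D G}

variable (H V) in
/-- The weight space of the odd part, as a subspace of the graded Lie algebra. -/
def oddWt (χ : Dual K H) : Submodule K G := V.toSubmodule ⊓ wt H G χ

lemma coe_mem_wt {χ : Dual K H} {x : D} (hx : x ∈ wt H D χ) : (x : G) ∈ wt H G χ :=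
  fun h ↦ congrArg Subtype.val (hx h)

lemma mem_wt_of_coe {χ : Dual K H} {x : D} (hx : (x : G) ∈ wt H G χ) : x ∈ wt H D χ :=
  fun h ↦ Subtype.ext (hx h)

lemma lie_mem_wt_add {χ ψ : Dual K H} {x y : G} (hx : x ∈ wt H G χ) (hy : y ∈ wt H G ψ) :
    ⁅x, y⁆ ∈ wt H G (χ + ψ) := by
  intro h
  have h1 : ⁅((h : D) : G), x⁆ = χ h • x := hx h
  have h2 : ⁅((h : D) : G), y⁆ = ψ h • y := hy h
  change ⁅((h : D) : G), ⁅x, y⁆⁆ = _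
  rw [leibniz_lie, h1, h2, smul_lie, lie_smul, LinearMap.add_apply, add_smul]

lemma killingForm_eq_zero_of_mem_wt {χ ψ : Dual K H} {x y : G} (hx : x ∈ wt H G χ)
    (hy : y ∈ wt H G ψ) (h : χ + ψ ≠ 0) : killingForm K G x y = 0 := by
  obtain ⟨z, hz⟩ : ∃ z, (χ + ψ) z ≠ 0 := by
    by_contra! hc
    exact h (LinearMap.ext hc)
  have h1 : ⁅((z : D) : G), x⁆ = χ z • x := hx z
  have h2 : ⁅((z : D) : G), y⁆ = ψ z • y := hy z
  have := killingForm_lie_left (K := K) ((z : D) : G) x y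
  rw [h1, h2, map_smul, map_smul, LinearMap.smul_apply, smul_eq_mul, smul_eq_mul] at this
  refine (mul_eq_zero.mp (?_ : (χ + ψ) z * killingForm K G x y = 0)).resolve_left hz
  rw [LinearMap.add_apply]
  linear_combination this

lemma lie_mem_odd {x y : G} (hx : x ∈ D) (hy : y ∈ V) :
    ⁅x, y⁆ ∈ V := V.lie_mem (x := ⟨x, hx⟩) hy

/-- The operator `ad x ∘ ad y` exchanges the even and the odd part, so its trace is zero. -/
lemma IsZ2Grading.killingForm_eq_zero (hV : IsZ2Grading D V) {x y : G} (hx : x ∈ D) (hy : y ∈ V) :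
    killingForm K G x y = 0 := by
  have hint : DirectSum.IsInternal (fun i : Bool ↦ cond i D.toSubmodule V.toSubmodule) := by
    rw [DirectSum.isInternal_submodule_iff_isCompl _ (i := true) (j := false) (by simp)
      (by ext i; cases i <;> simp)]
    exact hV.isCompl
  rw [killingForm_apply_apply]
  refine LinearMap.trace_eq_zero_of_mapsTo_ne hint not (by simp) fun i ↦ ?_
  cases i
  · intro v hv
    exact D.lie_mem hx (hV.lie_mem y hy v hv)
  · intro d hd
    change ⁅x, ⁅y, d⁆⁆ ∈ V
    rw [← lie_skew y d, lie_neg]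
    exact V.neg_mem (lie_mem_odd hx (lie_mem_odd hd hy))

lemma IsZ2Grading.exists_add (hV : IsZ2Grading D V) (x : G) : ∃ d ∈ D, ∃ v ∈ V, d + v = x :=
  Submodule.mem_sup.mp (hV.isCompl.sup_eq_top ▸ Submodule.mem_top :
    x ∈ D.toSubmodule ⊔ V.toSubmodule)

variable [IsKilling K G]

lemma eq_zero_of_killingForm_eq_zero {x : G} (h : ∀ y, killingForm K G x y = 0) : x = 0 :=
  (killingForm_nondegenerate K G).1 x h

lemma IsZ2Grading.exists_killingForm_ne_zero (hV : IsZ2Grading D V)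
    (hspan : V.toSubmodule ≤ ⨆ χ, oddWt H V χ) {χ : Dual K H} {x : G} (hx : x ∈ oddWt H V χ)
    (hx0 : x ≠ 0) : ∃ y ∈ oddWt H V (-χ), killingForm K G x y ≠ 0 := by
  by_contra! hc
  refine hx0 (eq_zero_of_killingForm_eq_zero (K := K) fun g ↦ ?_)
  obtain ⟨d, hd, v, hv, rfl⟩ := hV.exists_add g
  rw [map_add, LieModule.traceForm_comm, hV.killingForm_eq_zero hd hx.1, zero_add]
  refine (show V.toSubmodule ≤ LinearMap.ker (killingForm K G x) from
    hspan.trans (iSup_le fun ψ w hw ↦ ?_)) hv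
  by_cases h : χ + ψ = 0
  · obtain rfl := eq_neg_of_add_eq_zero_right h
    exact hc w hw
  · exact killingForm_eq_zero_of_mem_wt hx.2 hw.2 h

variable [IsKilling K D] [H.IsCartanSubalgebra] [LieModule.IsTriangularizable K H D]

lemma coe_mem_wt_zero (h : H) : ((h : D) : G) ∈ wt H G 0 := by
  refine coe_mem_wt fun h' ↦ ?_
  have : ⁅h', h⁆ = 0 := trivial_lie_zero _ _ _ _
  simpa using congrArg Subtype.val this

/-- The Killing form of `G` is nondegenerate on the Cartan subalgebra of `D`, because that
subalgebra is orthogonal to `V` and to all root spaces of `D`. -/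
lemma IsZ2Grading.cartan_eq_zero (hV : IsZ2Grading D V) {t : H}
    (ht : ∀ h : H, killingForm K G ((h : D) : G) ((t : D) : G) = 0) : t = 0 := by
  have : ((t : D) : G) = 0 := by
    refine eq_zero_of_killingForm_eq_zero (K := K) fun g ↦ ?_
    obtain ⟨d, hd, v, hv, rfl⟩ := hV.exists_add g
    rw [map_add, hV.killingForm_eq_zero (t : D).2 hv, add_zero]
    have := eq_top_of_cartan_le_of_rootSpace_le (H := H)
      ((LinearMap.ker (killingForm K G ((t : D) : G))).comap D.toSubmodule.subtype)
      (fun x hx ↦ (LieModule.traceForm_comm _ _ _ _ _).trans (ht ⟨x, hx⟩)) (fun α x hx ↦ by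
        rw [rootSpace_eq_wt] at hx
        refine killingForm_eq_zero_of_mem_wt (coe_mem_wt_zero t) (coe_mem_wt hx) ?_
        rw [zero_add]
        exact (rootSystem H).ne_zero α)
    exact (this ▸ Submodule.mem_top : (⟨d, hd⟩ : D) ∈ _)
  exact Subtype.ext (Subtype.ext this)

/-- The bracket has weight zero, so it lies in the Cartan subalgebra and is determined by `κ(h, [x,
y]) = α(h) κ(x, y)`. An even triple with `[e, f] = α^∨` obeys the same rule, whence `c = 1 / κ(e,
f)`. -/
lemma IsZ2Grading.exists_lie_eq_smul_coroot (hV : IsZ2Grading D V) (α : H.root) :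
    ∃ c : K, c ≠ 0 ∧ ∀ x ∈ oddWt H V α.1.toLinear, ∀ y ∈ oddWt H V (-α.1.toLinear),
      ⁅x, y⁆ = (c * killingForm K G x y) • (((coroot α.1 : H) : D) : G) := by
  obtain ⟨e, f, t, he, hf⟩ := exists_sl2Triple α
  replace he := coe_mem_wt (mem_wt_of_mem_rootSpace he)
  have key {x y : G} (hx : x ∈ wt H G α.1.toLinear) (h : H) :
      killingForm K G ((h : D) : G) ⁅x, y⁆ = α.1 h * killingForm K G x y := by
    have h1 : ⁅((h : D) : G), x⁆ = α.1 h • x := hx h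
    rw [killingForm, ← LieModule.traceForm_apply_lie_apply, h1, map_smul, LinearMap.smul_apply]
    rfl
  have hef : ⁅(e : G), (f : G)⁆ = (((coroot α.1 : H) : D) : G) := congrArg Subtype.val t.lie_e_f
  have hc0 : killingForm K G (e : G) (f : G) ≠ 0 := by
    intro h0
    refine t.h_ne_zero ?_
    rw [hV.cartan_eq_zero (t := coroot α.1) fun h ↦ by rw [← hef, key he, h0, mul_zero]]
    rfl
  refine ⟨(killingForm K G (e : G) (f : G))⁻¹, inv_ne_zero hc0, fun x hx y hy ↦ ?_⟩
  have hD : ⁅x, y⁆ ∈ D := hV.lie_mem x hx.1 y hy.1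
  have hH : (⟨⁅x, y⁆, hD⟩ : D) ∈ H := by
    refine mem_cartan_of_mem_wt_zero (mem_wt_of_coe ?_)
    simpa using lie_mem_wt_add hx.2 hy.2
  set s : H := ⟨⟨⁅x, y⁆, hD⟩, hH⟩
  have : s - ((killingForm K G (e : G) (f : G))⁻¹ * killingForm K G x y) • coroot α.1 = 0 := by
    refine hV.cartan_eq_zero fun h ↦ ?_
    change killingForm K G ((h : D) : G) (⁅x, y⁆ - _ • (((coroot α.1 : H) : D) : G)) = 0
    rw [map_sub, key hx.2, map_smul, ← hef, key he, smul_eq_mul]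
    field_simp
    ring
  exact congrArg (fun s : H ↦ ((s : D) : G)) (sub_eq_zero.mp this)

/-- Root vectors in the odd part extend to `sl₂`-triples. -/
lemma IsZ2Grading.exists_sl2Triple (hV : IsZ2Grading D V)
    (hspan : V.toSubmodule ≤ ⨆ χ, oddWt H V χ) (α : H.root) {x : G}
    (hx : x ∈ oddWt H V α.1.toLinear) (hx0 : x ≠ 0) : ∃ y ∈ oddWt H V (-α.1.toLinear),
      IsSl2Triple (((coroot α.1 : H) : D) : G) x y := by
  obtain ⟨y, hy, hxy⟩ := hV.exists_killingForm_ne_zero hspan hx hx0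
  obtain ⟨c, hc, h⟩ := hV.exists_lie_eq_smul_coroot α
  have hα := root_apply_coroot (H.isNonZero_coe_root α)
  have h1 : ∀ w ∈ wt H G α.1.toLinear, ⁅(((coroot α.1 : H) : D) : G), w⁆ = 2 • w := by
    intro w hw
    refine (hw (coroot α.1)).trans ?_
    rw [LieModule.Weight.toLinear_apply, hα, ofNat_smul_eq_nsmul]
  have h2 : ∀ w ∈ wt H G (-α.1.toLinear), ⁅(((coroot α.1 : H) : D) : G), w⁆ = -(2 • w) := by
    intro w hw
    refine (hw (coroot α.1)).trans ?_
    rw [LinearMap.neg_apply, LieModule.Weight.toLinear_apply, hα, neg_smul, ofNat_smul_eq_nsmul]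
  refine ⟨(c * killingForm K G x y)⁻¹ • y, Submodule.smul_mem _ _ hy, ?_, ?_, h1 x hx.2,
    h2 _ (Submodule.smul_mem _ _ hy.2)⟩
  · intro h0
    have h0' : (coroot α.1 : H) = 0 := Subtype.ext (Subtype.ext h0)
    rw [h0', map_zero] at hα
    norm_num at hα
  · rw [lie_smul, h x hx y hy, smul_smul, inv_mul_cancel₀ (mul_ne_zero hc hxy), one_smul]

/-- The weight spaces of the odd part for roots have dimension at most one. -/
lemma IsZ2Grading.exists_smul_eq (hV : IsZ2Grading D V)
    (hspan : V.toSubmodule ≤ ⨆ χ, oddWt H V χ) (α : H.root) {x y : G}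
    (hx : x ∈ oddWt H V α.1.toLinear) (hx0 : x ≠ 0) (hy : y ∈ oddWt H V α.1.toLinear) :
    ∃ c : K, c • x = y := by
  obtain ⟨f, hf, t⟩ := hV.exists_sl2Triple hspan α hx hx0
  obtain ⟨c, hc, h⟩ := hV.exists_lie_eq_smul_coroot α
  have hκ : killingForm K G x f ≠ 0 := by
    intro h0
    have := h x hx f hf
    rw [t.lie_e_f, h0, mul_zero, zero_smul] at this
    exact t.h_ne_zero this
  refine ⟨killingForm K G y f / killingForm K G x f, ?_⟩
  by_contra hne
  -- This combination is orthogonal to `f`, so it commutes with `f`. A nonzero lowest weight vector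
  -- cannot have the positive weight `2`.
  set w := (killingForm K G y f / killingForm K G x f) • x - y
  have hw : w ∈ oddWt H V α.1.toLinear := Submodule.sub_mem _ (Submodule.smul_mem _ _ hx) hy
  have hwf : ⁅w, f⁆ = 0 := by
    rw [h w hw f hf]
    have : killingForm K G w f = 0 := by simp [w, hκ]
    rw [this, mul_zero, zero_smul]
  obtain ⟨n, hn⟩ := t.exists_nat_of_lie_f_eq_zero (K := K) (m := w) (sub_ne_zero.mpr hne)
    (hw.2 (coroot α.1)) (by rw [← lie_skew, hwf, neg_zero])
  rw [LieModule.Weight.toLinear_apply, root_apply_coroot (H.isNonZero_coe_root α)] at hn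
  have : (2 : ℤ) = -n := by exact_mod_cast hn
  lia

/-- The bracket of odd root vectors does not vanish if the sum of the roots is a root with positive
value on the coroot of one of them. -/
lemma IsZ2Grading.lie_ne_zero (hV : IsZ2Grading D V)
    (hspan : V.toSubmodule ≤ ⨆ χ, oddWt H V χ) {α β γ : H.root}
    (hγ : α.1.toLinear + β.1.toLinear = γ.1.toLinear) {n : ℕ} (hn : 0 < n)
    (hn' : γ.1 (coroot α.1) = n) {x y : G} (hx : x ∈ oddWt H V α.1.toLinear) (hx0 : x ≠ 0)
    (hy : y ∈ oddWt H V β.1.toLinear) (hy0 : y ≠ 0) : ⁅x, y⁆ ≠ 0 := by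
  intro hxy
  obtain ⟨f, hf, t⟩ := hV.exists_sl2Triple hspan α hx hx0
  obtain ⟨_, w, tw, _, hw⟩ := LongAbelian.exists_sl2Triple γ
  replace hw := coe_mem_wt (mem_wt_of_mem_rootSpace hw)
  rw [toLinear_reflectionPerm_self] at hw
  have hw0 : (w : G) ≠ 0 := fun h ↦ tw.f_ne_zero (Subtype.ext h)
  -- The weight of `w` on the coroot of `α` is `-n < 0`, so `x` cannot kill it. Then `[x, w]` pairs
  -- nontrivially with `y`, against `κ([x, w], y) = -κ(w, [x, y]) = 0`.
  have hxw : ⁅x, (w : G)⁆ ≠ 0 := by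
    intro h0
    have P : t.HasPrimitiveVectorWith (w : G) (-n : K) :=
      ⟨hw0, (hw (coroot α.1)).trans (by
        rw [LinearMap.neg_apply, LieModule.Weight.toLinear_apply, hn']), h0⟩
    obtain ⟨m, hm⟩ := P.exists_nat
    have : (-n : ℤ) = m := by exact_mod_cast hm
    lia
  have hxw' : ⁅x, (w : G)⁆ ∈ oddWt H V (-β.1.toLinear) := by
    refine ⟨?_, ?_⟩
    · rw [← lie_skew]
      exact V.neg_mem (lie_mem_odd w.2 hx.1)
    · rw [show -β.1.toLinear = α.1.toLinear + -γ.1.toLinear by rw [← hγ]; abel]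
      exact lie_mem_wt_add hx.2 hw
  obtain ⟨y', hy', hne⟩ := hV.exists_killingForm_ne_zero hspan hxw' hxw
  rw [neg_neg] at hy'
  obtain ⟨c, rfl⟩ := hV.exists_smul_eq hspan β hy hy0 hy'
  apply hne
  rw [map_smul, killingForm_lie_left, hxy, map_zero, neg_zero, smul_zero]

end Graded

/-! ### The little adjoint module of the dual Lie algebra and its weights -/

section Dual

variable {K D : Type*} [Field K] [CharZero K] [LieRing D] [LieAlgebra K D] [FiniteDimensional K D]
  [IsKilling K D] {H : LieSubalgebra K D} [H.IsCartanSubalgebra] [LieModule.IsTriangularizable K H D]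
  {ι X Y : Type*} [Fintype ι] [AddCommGroup X] [Module K X] [AddCommGroup Y] [Module K Y]
  {P : RootPairing ι K X Y} (e : RootPairing.Equiv P.flip (rootSystem H))

/-- The root, as a linear form, corresponding to the coroot with index `i` under an identification
of the dual root system. -/
noncomputable def dualRoot (i : ι) : Dual K H := (e.indexEquiv i).1.toLinear

variable {e}

lemma dualRoot_eq (i : ι) : dualRoot e i = e.weightMap (P.coroot i) :=
  (RootPairing.Hom.root_weightMap_apply P.flip (rootSystem H) i e.toHom).symm

lemma dualRoot_injective : Function.Injective (dualRoot e) :=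
  (rootSystem H).root.injective.comp e.indexEquiv.injective

lemma coroot_add_iff {i j k : ι} :
    P.coroot i + P.coroot j = P.coroot k ↔ dualRoot e i + dualRoot e j = dualRoot e k := by
  simp only [dualRoot_eq, ← map_add, e.bijective_weightMap.injective.eq_iff]

lemma exists_dualRoot_eq (α : H.root) : ∃ i, e.indexEquiv i = α ∧ dualRoot e i = α.1.toLinear :=
  ⟨e.indexEquiv.symm α, by simp, by simp [dualRoot]⟩

variable [P.IsCrystallographic]

lemma dualRoot_apply_coroot (i j : ι) :
    dualRoot e i (coroot (e.indexEquiv j).1) = P.pairingIn ℤ j i := by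
  have h := RootPairing.Hom.weight_coweight_transpose_apply P.flip (rootSystem H)
    (coroot (e.indexEquiv j).1) e.toHom
  have h1 := LinearMap.congr_fun h (P.coroot i)
  have h2 : e.coweightMap (coroot (e.indexEquiv j).1) = P.root j := by
    simpa using! congrFun e.coroot_coweightMap (e.indexEquiv j)
  rw [dualRoot_eq, ← eq_intCast (algebraMap ℤ K), P.algebraMap_pairingIn ℤ]
  rw [h2] at h1
  simpa using! h1

lemma dualRoot_reflectionPerm (i j : ι) :
    dualRoot e (P.reflectionPerm j i) = dualRoot e i - P.pairingIn ℤ j i • dualRoot e j := by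
  simp only [dualRoot_eq, coroot_reflectionPerm_eq, map_sub, map_zsmul]

lemma dualRoot_reflectionPerm_self (i : ι) :
    dualRoot e (P.reflectionPerm i i) = -dualRoot e i := by
  simp only [dualRoot_eq, coroot_reflectionPerm_self, map_neg]

lemma indexEquiv_reflectionPerm_self (i : ι) :
    e.indexEquiv (P.reflectionPerm i i) = (rootSystem H).reflectionPerm (e.indexEquiv i)
      (e.indexEquiv i) := by
  apply (rootSystem H).root.injective
  rw [root_reflectionPerm_self]
  exact dualRoot_reflectionPerm_self i

variable [P.IsReduced] [P.IsIrreducible] [P.IsRootSystem] {b : P.Base} {θ : ι}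

lemma exists_dualRoot_apply_pos (hP : IsDoublyLaced P) (hθ : IsHighestRoot b θ) :
    ∃ z : H, ∀ i, b.IsPos i → ∃ k : ℕ, 0 < k ∧ dualRoot e i z = k := by
  obtain ⟨f, hf⟩ := hP.exists_coweight_pos hθ.isLong b
  obtain ⟨z, hz⟩ := (evalEquiv K H).surjective (f ∘ₗ (RootPairing.Equiv.weightEquiv _ _ e).symm)
  refine ⟨z, fun i hi ↦ ?_⟩
  obtain ⟨k, hk, hfk⟩ := hf i hi
  refine ⟨k, hk, ?_⟩
  have := LinearMap.congr_fun hz (dualRoot e i)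
  rw [← hfk]
  simpa [dualRoot_eq] using! this

lemma mem_image_isPos_or (α : H.root) : α ∈ e.indexEquiv '' {i | b.IsPos i} ∨
    (rootSystem H).reflectionPerm α α ∈ e.indexEquiv '' {i | b.IsPos i} := by
  obtain ⟨i, rfl, -⟩ := exists_dualRoot_eq (e := e) α
  rcases isPos_or_isPos_reflectionPerm_self (b := b) i with h | h
  · exact .inl ⟨i, h, rfl⟩
  · exact .inr ⟨_, h, indexEquiv_reflectionPerm_self i⟩

variable {M : Type*} [AddCommGroup M] [Module K M] [LieRingModule D M] [LieModule K D M]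

lemma exists_nat_apply_eq (hM : LieModule.IsIrreducible K D M) {z : H}
    (hz : ∀ i, b.IsPos i → ∃ k : ℕ, 0 < k ∧ dualRoot e i z = k) {v : M} (hv0 : v ≠ 0)
    {χ : Dual K H} (hv : v ∈ wt H M χ)
    (hvS : ∀ i, b.IsPos i → ∀ x ∈ rootSpace H (e.indexEquiv i).1, ⁅x, v⁆ = 0) {μ : Dual K H}
    (hμ : wt H M μ ≠ ⊥) : ∃ k : ℕ, μ z = χ z - k := by
  refine exists_nat_apply_eq_of_highest (S := e.indexEquiv '' {i | b.IsPos i}) mem_image_isPos_or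
    ?_ hv0 hv ?_ hμ
  · rintro _ ⟨i, hi, rfl⟩
    obtain ⟨k, -, hk⟩ := hz i hi
    exact ⟨k, hk⟩
  · rintro _ ⟨i, hi, rfl⟩
    exact hvS i hi

variable [FiniteDimensional K M]

lemma wt_sub_dualRoot_ne_bot (j : ι) {χ : Dual K H} (hχ : wt H M χ ≠ ⊥) {n : ℤ}
    (hn : χ (coroot (e.indexEquiv j).1) = n) : wt H M (χ - n • dualRoot e j) ≠ ⊥ :=
  wt_sub_ne_bot _ hχ hn

lemma apply_sub_nat_of_isHighestWeightModule
    (hM : IsHighestWeightModule H (e.indexEquiv '' {i | b.IsPos i}) M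
      ((e.indexEquiv θ).1 : H → K)) {z : H}
    (hz : ∀ i, b.IsPos i → ∃ k : ℕ, 0 < k ∧ dualRoot e i z = k) {μ : Dual K H}
    (hμ : wt H M μ ≠ ⊥) : ∃ k : ℕ, μ z = dualRoot e θ z - k := by
  obtain ⟨v, hv0, hv, hvS⟩ := hM.exists_highest
  exact exists_nat_apply_eq hM.irreducible hz hv0 (χ := dualRoot e θ) hv
    (fun i hi ↦ hvS _ ⟨i, hi, rfl⟩) hμ

lemma wt_dualRoot_ne_bot (hθ : IsHighestRoot b θ)
    (hM : IsHighestWeightModule H (e.indexEquiv '' {i | b.IsPos i}) M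
      ((e.indexEquiv θ).1 : H → K)) {i : ι} (hi : IsLong P i) : wt H M (dualRoot e i) ≠ ⊥ := by
  refine forall_isLong_of_stable (P := P) (A := fun i ↦ wt H M (dualRoot e i) ≠ ⊥)
    (fun i hi j ↦ ?_) hθ.isLong ?_ i hi
  · rw [dualRoot_reflectionPerm]
    exact wt_sub_dualRoot_ne_bot j hi (dualRoot_apply_coroot i j)
  · obtain ⟨v, hv0, hv, -⟩ := hM.exists_highest
    exact fun hb ↦ hv0 ((Submodule.eq_bot_iff _).mp hb v hv)

/-- The assertion, for all `j` at once, is invariant under reflecting `i` and `j` together, so it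
suffices to treat `i = θ`. -/
lemma wt_add_eq_bot (hP : IsDoublyLaced P) (hθ : IsHighestRoot b θ)
    (hM : IsHighestWeightModule H (e.indexEquiv '' {i | b.IsPos i}) M
      ((e.indexEquiv θ).1 : H → K)) {i : ι} (hi : IsLong P i) {j : ι}
    (hj : 0 ≤ P.pairingIn ℤ j i) : wt H M (dualRoot e i + dualRoot e j) = ⊥ := by
  refine forall_isLong_of_stable (P := P) (A := fun i ↦ ∀ j, 0 ≤ P.pairingIn ℤ j i →
    wt H M (dualRoot e i + dualRoot e j) = ⊥) (fun i hi k j hj ↦ ?_) hθ.isLong ?_ i hi j hj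
  · by_contra hne
    rw [P.pairingIn_reflectionPerm] at hj
    have := wt_sub_dualRoot_ne_bot (e := e) k hne
      (n := P.pairingIn ℤ k (P.reflectionPerm k i) + P.pairingIn ℤ k j) (by
        rw [LinearMap.add_apply, dualRoot_apply_coroot, dualRoot_apply_coroot, Int.cast_add])
    refine this (hi (P.reflectionPerm k j) hj ▸ congrArg _ ?_)
    rw [dualRoot_reflectionPerm, dualRoot_reflectionPerm, pairingIn_reflectionPerm_right,
      P.pairingIn_same]
    module
  · intro j hj
    obtain ⟨z, hz⟩ := exists_dualRoot_apply_pos (e := e) hP hθ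
    have key : ∀ k, b.IsPos k → ∀ m : ℕ, 0 < m → wt H M (dualRoot e θ + m • dualRoot e k) = ⊥ := by
      intro k hk m hm
      by_contra hne
      obtain ⟨n, hn⟩ := apply_sub_nat_of_isHighestWeightModule hM hz hne
      obtain ⟨l, hl, hl'⟩ := hz k hk
      rw [LinearMap.add_apply, LinearMap.smul_apply, hl', sub_eq_add_neg, add_right_inj] at hn
      have : (m * l + n : K) = 0 := by rw [← nsmul_eq_mul, hn]; ring
      have : m * l + n = 0 := by exact_mod_cast this
      have := Nat.mul_pos hm hl
      lia
    rcases isPos_or_isPos_reflectionPerm_self (b := b) j with h | h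
    · simpa using key j h 1 one_pos
    · by_contra hne
      -- For `j` negative, reflecting in `j` turns `θ^∨ + j^∨` into `θ^∨ + m(-j)^∨` with `m = ⟨j,
      -- θ^∨⟩ + 1 ≥ 1`, again above the highest weight.
      have h1 := wt_sub_dualRoot_ne_bot (e := e) j hne (n := P.pairingIn ℤ j θ + 2) (by
        rw [LinearMap.add_apply, dualRoot_apply_coroot, dualRoot_apply_coroot,
          P.pairingIn_same, Int.cast_add, Int.cast_ofNat])
      obtain ⟨m, hm⟩ : ∃ m : ℕ, (m : ℤ) = P.pairingIn ℤ j θ + 1 :=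
        ⟨(P.pairingIn ℤ j θ + 1).toNat, by lia⟩
      refine h1 (key _ h m (by lia) ▸ congrArg _ ?_)
      rw [dualRoot_reflectionPerm_self, ← natCast_zsmul, hm]
      module

lemma wt_dualRoot_eq_bot (hP : IsDoublyLaced P) (hθ : IsHighestRoot b θ)
    (hM : IsHighestWeightModule H (e.indexEquiv '' {i | b.IsPos i}) M
      ((e.indexEquiv θ).1 : H → K)) {j : ι} (hj : ¬ IsLong P j) :
    wt H M (dualRoot e j) = ⊥ := by
  obtain ⟨i, hi, h1, h2⟩ := hP.exists_pairingIn_eq hθ.isLong hj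
  -- For `k = -s_j i` one has `j^∨ = i^∨ + k^∨` with `i` long and `⟨k, i^∨⟩ = 0`, a sum excluded by
  -- `wt_add_eq_bot`.
  set k := P.reflectionPerm (P.reflectionPerm j i) (P.reflectionPerm j i)
  have hk : dualRoot e k = dualRoot e j - dualRoot e i := by
    rw [dualRoot_reflectionPerm_self, dualRoot_reflectionPerm, h2]
    module
  rw [show dualRoot e j = dualRoot e i + dualRoot e k by rw [hk]; abel]
  refine wt_add_eq_bot hP hθ hM hi ?_
  simp only [k, pairingIn_reflectionPerm_left, P.pairingIn_same]
  rw [h1, h2]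
  norm_num

/-- The weights of the little adjoint module. -/
lemma iSup_wt_eq_top (hP : IsDoublyLaced P) (hθ : IsHighestRoot b θ)
    (hM : IsHighestWeightModule H (e.indexEquiv '' {i | b.IsPos i}) M
      ((e.indexEquiv θ).1 : H → K)) :
    ⨆ χ ∈ insert 0 (dualRoot e '' {i | IsLong P i}), wt H M χ = ⊤ := by
  have := hM.irreducible
  set Λ : Set (Dual K H) := insert 0 (dualRoot e '' {i | IsLong P i})
  have hmem {χ : Dual K H} (hχ : wt H M χ ≠ ⊥ → χ ∈ Λ) {m : M} (hm : m ∈ wt H M χ) :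
      m ∈ ⨆ χ ∈ Λ, wt H M χ := by
    by_cases h : wt H M χ = ⊥
    · rw [h, Submodule.mem_bot] at hm
      rw [hm]; exact Submodule.zero_mem _
    · exact Submodule.mem_iSup_of_mem χ (Submodule.mem_iSup_of_mem (hχ h) hm)
  refine eq_top_of_stable (H := H) ?_ (fun h m hm ↦ ?_) (fun α x hx m hm ↦ ?_)
  · intro hb
    have h1 := wt_dualRoot_ne_bot hθ hM hθ.isLong
    refine h1 (eq_bot_iff.mpr (hb ▸ fun m hm ↦ ?_))
    exact hmem (fun _ ↦ Set.mem_insert_of_mem _ ⟨θ, hθ.isLong, rfl⟩) hm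
  · obtain ⟨f, hf, rfl⟩ := exists_components_of_mem_biSup hm
    rw [lie_sum]
    refine Submodule.sum_mem _ fun χ hχ ↦ ?_
    rw [(hf χ hχ).2 h]
    exact Submodule.smul_mem _ _ (hmem (fun _ ↦ (hf χ hχ).1) (hf χ hχ).2)
  · obtain ⟨f, hf, rfl⟩ := exists_components_of_mem_biSup hm
    obtain ⟨j, rfl, hj⟩ := exists_dualRoot_eq (e := e) α
    rw [lie_sum]
    refine Submodule.sum_mem _ fun χ hχ ↦ ?_
    obtain ⟨hχΛ, hfχ⟩ := hf χ hχ
    have h1 := lie_mem_wt _ hx hfχ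
    rw [← hj] at h1
    refine hmem (fun hne ↦ ?_) h1
    rcases hχΛ with rfl | ⟨i, hi, rfl⟩
    · rw [zero_add] at hne ⊢
      refine Set.mem_insert_of_mem _ ⟨j, ?_, rfl⟩
      by_contra hj'
      exact hne (wt_dualRoot_eq_bot hP hθ hM hj')
    -- A negative pairing with the coroot of the long root `i` is either `-1`, where the new weight
    -- is the coroot of `s_j i`, or it forces `j = -i`, where the new weight is `0`.
    · have hneg : P.pairingIn ℤ j i < 0 := by
        by_contra! hc
        exact hne (wt_add_eq_bot hP hθ hM hi hc)
      by_cases h2 : P.pairingIn ℤ j i = -1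
      · refine Set.mem_insert_of_mem _ ⟨P.reflectionPerm j i, IsLong.reflectionPerm hi j, ?_⟩
        rw [dualRoot_reflectionPerm, h2]
        module
      · rw [hP.eq_reflectionPerm_self_of_pairingIn_neg hi hneg h2, dualRoot_reflectionPerm_self,
          add_neg_cancel]
        exact Set.mem_insert _ _

/-- The nonzero vectors of weight zero in the little adjoint module are not highest weight
vectors. -/
lemma exists_lie_ne_zero (hP : IsDoublyLaced P) (hθ : IsHighestRoot b θ)
    (hM : IsHighestWeightModule H (e.indexEquiv '' {i | b.IsPos i}) M
      ((e.indexEquiv θ).1 : H → K)) {u : M} (hu0 : u ≠ 0) (hu : u ∈ wt H M 0) :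
    ∃ i, b.IsPos i ∧ ∃ x ∈ rootSpace H (e.indexEquiv i).1, ⁅x, u⁆ ≠ 0 := by
  by_contra! hc
  obtain ⟨z, hz⟩ := exists_dualRoot_apply_pos (e := e) hP hθ
  -- If `u` were a highest weight vector, every weight would be nonpositive at `z`, whereas `θ^∨` is
  -- positive there.
  obtain ⟨k, hk⟩ := exists_nat_apply_eq hM.irreducible hz hu0 hu hc
    (wt_dualRoot_ne_bot hθ hM hθ.isLong)
  obtain ⟨l, hl, hl'⟩ := hz θ hθ.isPos
  rw [hl', LinearMap.zero_apply, zero_sub] at hk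
  have : (l : ℤ) = -k := by exact_mod_cast hk
  lia

end Dual

/-! ### Borel subalgebras and their Abelian ideals -/

section Borel

variable {K D : Type*} [Field K] [CharZero K] [LieRing D] [LieAlgebra K D] [FiniteDimensional K D]
  {H : LieSubalgebra K D} [H.IsCartanSubalgebra]
  {M : Type*} [AddCommGroup M] [Module K M] [LieRingModule D M] [LieModule K D M]

lemma lie_mem_of_mem_borel {S : Set H.root} {a : Submodule K M}
    (h0 : ∀ h : H, ∀ m ∈ a, ⁅(h : D), m⁆ ∈ a)
    (hS : ∀ i ∈ S, ∀ x ∈ rootSpace H i.1, ∀ m ∈ a, ⁅x, m⁆ ∈ a) :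
    ∀ x ∈ borel H S, ∀ m ∈ a, ⁅x, m⁆ ∈ a := by
  intro x hx m hm
  refine (show borel H S ≤
    a.comap ((LieModule.toEnd K D M : D →ₗ[K] Module.End K M).flip m) from
    sup_le (fun y hy ↦ h0 ⟨y, hy⟩ m hm) (iSup₂_le fun i hi y hy ↦ hS i hi y hy m hm)) hx

lemma lie_mem_of_mem_biSup {ι : Type*} {U : ι → Submodule K M} {I : Set ι} {x : D}
    {N : Submodule K M} (h : ∀ i ∈ I, ∀ m ∈ U i, ⁅x, m⁆ ∈ N) {m : M} (hm : m ∈ ⨆ i ∈ I, U i) :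
    ⁅x, m⁆ ∈ N :=
  (show ⨆ i ∈ I, U i ≤ N.comap (LieModule.toEnd K D M x) from iSup₂_le h) hm

lemma lie_eq_zero_of_mem_biSup {ι : Type*} {U : ι → Submodule K D} {I : Set ι}
    (h : ∀ i ∈ I, ∀ x ∈ U i, ∀ j ∈ I, ∀ y ∈ U j, ⁅x, y⁆ = 0) {x y : D}
    (hx : x ∈ ⨆ i ∈ I, U i) (hy : y ∈ ⨆ i ∈ I, U i) : ⁅x, y⁆ = 0 := by
  refine (Submodule.mem_bot K).mp (lie_mem_of_mem_biSup (fun j hj z hz ↦ ?_) hy)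
  rw [Submodule.mem_bot, ← lie_skew, neg_eq_zero]
  exact (Submodule.mem_bot K).mp
    (lie_mem_of_mem_biSup (fun i hi w hw ↦ (Submodule.mem_bot K).mpr (h j hj z hz i hi w hw)) hx)

variable [IsKilling K D] [LieModule.IsTriangularizable K H D] [FiniteDimensional K M]

lemma mem_borel_of_mem_cartan {S : Set H.root} (h : H) : (h : D) ∈ borel H S :=
  Submodule.mem_sup_left h.2

lemma mem_borel_of_mem_rootSpace {S : Set H.root} {i : H.root} (hi : i ∈ S) {x : D}
    (hx : x ∈ rootSpace H i.1) : x ∈ borel H S :=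
  Submodule.mem_sup_right (Submodule.mem_iSup_of_mem i (Submodule.mem_iSup_of_mem hi hx))

/-- Root vectors act injectively on vectors with negative weight on the coroot. -/
lemma lie_ne_zero_of_apply_coroot_neg {α : H.root} {x : D} (hx : x ∈ rootSpace H α.1) (hx0 : x ≠ 0)
    {χ : Dual K H} {m : M} (hm : m ∈ wt H M χ) (hm0 : m ≠ 0) {n : ℤ} (hn : n < 0)
    (h : χ (coroot α.1) = n) : ⁅x, m⁆ ≠ 0 := by
  intro hxm
  obtain ⟨e, f, t, he, -⟩ := exists_sl2Triple α
  obtain ⟨c, rfl⟩ := exists_smul_eq_of_mem_rootSpace α hx hx0 he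
  have P : t.HasPrimitiveVectorWith m (n : K) :=
    ⟨hm0, (hm (coroot α.1)).trans (by rw [h]), by rw [smul_lie, hxm, smul_zero]⟩
  obtain ⟨k, hk⟩ := P.exists_nat
  have : n = k := by exact_mod_cast hk
  lia

lemma exists_mem_rootSpace_ne_zero (α : H.root) : ∃ x ∈ rootSpace H α.1, x ≠ 0 := by
  obtain ⟨e, f, t, he, -⟩ := exists_sl2Triple α
  exact ⟨e, he, t.e_ne_zero⟩

lemma exists_killingForm_ne_zero (α : H.root) {x : D} (hx : x ∈ wt H D (-α.1.toLinear))
    (hx0 : x ≠ 0) : ∃ y ∈ rootSpace H α.1, killingForm K D x y ≠ 0 := by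
  by_contra! hc
  rw [← toLinear_reflectionPerm_self, ← rootSpace_eq_wt] at hx
  have := mem_ker_killingForm_of_mem_rootSpace_of_forall_rootSpace_neg K D H hx (fun y hy ↦ hc y (by
    rw [coe_reflectionPerm_self, LieModule.Weight.coe_neg, neg_neg] at hy
    exact hy))
  rw [ker_killingForm_eq_bot] at this
  exact hx0 this

/-- The bracket of two root spaces does not vanish if the sum of the roots is a root. -/
lemma lie_ne_zero_of_add_eq {α β γ : H.root}
    (hγ : α.1.toLinear + β.1.toLinear = γ.1.toLinear) {x y : D} (hx : x ∈ rootSpace H α.1)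
    (hx0 : x ≠ 0) (hy : y ∈ rootSpace H β.1) (hy0 : y ≠ 0) : ⁅x, y⁆ ≠ 0 := by
  intro hxy
  have hyw := mem_wt_of_mem_rootSpace hy
  have hn := (rootSystem H).algebraMap_pairingIn ℤ β α
  rw [eq_intCast, rootSystem_pairing_apply] at hn
  have h0 : 0 ≤ (rootSystem H).pairingIn ℤ β α := by
    by_contra! hneg
    exact lie_ne_zero_of_apply_coroot_neg hx hx0 hyw hy0 hneg hn.symm hxy
  obtain ⟨w, hw, hw0⟩ := exists_mem_rootSpace_ne_zero ((rootSystem H).reflectionPerm γ γ)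
  replace hw := mem_wt_of_mem_rootSpace hw
  rw [toLinear_reflectionPerm_self, ← hγ] at hw
  -- Since `⟨β, α^∨⟩ ≥ 0`, the vector `w` of weight `-(α + β)` is negative on the coroot of `α`. As
  -- `[x, w]` then pairs nontrivially with `y`, invariance of the Killing form contradicts `[x, y] =
  -- 0`.
  have hxw : ⁅x, w⁆ ≠ 0 := by
    refine lie_ne_zero_of_apply_coroot_neg hx hx0 hw hw0
      (n := -(2 + (rootSystem H).pairingIn ℤ β α)) (by lia) ?_
    rw [LinearMap.neg_apply, LinearMap.add_apply, LieModule.Weight.toLinear_apply,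
      LieModule.Weight.toLinear_apply, root_apply_coroot (H.isNonZero_coe_root α), ← hn]
    push_cast
    ring
  have hxw' := lie_mem_wt α hx hw
  rw [show -(α.1.toLinear + β.1.toLinear) + α.1.toLinear = -β.1.toLinear by abel] at hxw'
  obtain ⟨y', hy', hne⟩ := exists_killingForm_ne_zero β hxw' hxw
  obtain ⟨c, rfl⟩ := exists_smul_eq_of_mem_rootSpace β hy hy0 hy'
  apply hne
  rw [map_smul, killingForm_lie_left, hxy, map_zero, neg_zero, smul_zero]

lemma rootSpaceSum_eq (I : Set H.root) :
    rootSpaceSum H I = ⨆ χ ∈ (fun i : H.root ↦ i.1.toLinear) '' I, wt H D χ := by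
  simp only [rootSpaceSum, iSup_image, rootSpace_eq_wt]

lemma mem_of_mem_rootSpaceSum {I : Set H.root} {i : H.root} {x : D} (hx : x ∈ rootSpace H i.1)
    (hx0 : x ≠ 0) (h : x ∈ rootSpaceSum H I) : i ∈ I := by
  rw [rootSpaceSum_eq] at h
  obtain ⟨j, hj, hij⟩ := mem_of_mem_wt_of_mem_biSup (fun _ ↦ le_rfl) hx0
    (mem_wt_of_mem_rootSpace hx) h
  exact (rootSystem H).root.injective hij ▸ hj

lemma rootSpace_le_rootSpaceSum {I : Set H.root} {i : H.root} (hi : i ∈ I) :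
    (rootSpace H i.1).toSubmodule ≤ rootSpaceSum H I :=
  le_iSup₂_of_le i hi le_rfl

lemma IsPos.root_add_ne_zero {ι X Y : Type*} [AddCommGroup X] [Module K X] [AddCommGroup Y]
    [Module K Y] {P : RootPairing ι K X Y} {b : P.Base} {i j : ι} (hi : b.IsPos i)
    (hj : b.IsPos j) : P.root i + P.root j ≠ 0 := by
  intro h
  have : i = P.reflectionPerm j j := P.root.injective (by
    rw [RootPairing.root_reflectionPerm, RootPairing.reflection_apply_self]
    exact eq_neg_of_add_eq_zero_left h)
  subst this
  exact (RootPairing.Base.IsPos.neg_iff_not b j).mp hi hj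

/-- Combinatorial Abelian ideals correspond to Abelian ideals of the Borel subalgebra. -/
lemma isAbelianIdeal_iff_isAbelianBorelIdeal {b : (rootSystem H).Base} {I : Set H.root}
    (hI : ∀ i ∈ I, b.IsPos i) :
    IsAbelianIdeal b I ↔ IsAbelianBorelIdeal H {i | b.IsPos i} (rootSpaceSum H I) := by
  have hcases {i j : H.root} (hi : b.IsPos i) (hj : b.IsPos j) {x y : D}
      (hx : x ∈ rootSpace H i.1) (hy : y ∈ rootSpace H j.1) : ⁅x, y⁆ = 0 ∨
      ∃ k, (rootSystem H).root k = (rootSystem H).root i + (rootSystem H).root j ∧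
        ⁅x, y⁆ ∈ rootSpace H k.1 := by
    by_cases h0 : ⁅x, y⁆ = 0
    · exact .inl h0
    have hxy := lie_mem_wt i hx (mem_wt_of_mem_rootSpace hy)
    rw [add_comm] at hxy
    obtain ⟨k, hk⟩ := exists_root_of_mem_wt h0 (IsPos.root_add_ne_zero hi hj) hxy
    refine .inr ⟨k, hk, (rootSpace_eq_wt k).ge ?_⟩
    rwa [hk]
  constructor
  · intro h
    refine ⟨(iSup₂_le fun i hi ↦ rootSpace_le_rootSpaceSum (hI i hi)).trans le_sup_right,
      lie_mem_of_mem_borel (fun t m hm ↦ ?_) (fun j hj x hx m hm ↦ ?_), fun x hx y hy ↦ ?_⟩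
    · refine lie_mem_of_mem_biSup (fun i hi m hm ↦ ?_) hm
      rw [mem_wt_of_mem_rootSpace hm t]
      exact Submodule.smul_mem _ _ (rootSpace_le_rootSpaceSum hi hm)
    · refine lie_mem_of_mem_biSup (fun i hi m hm ↦ ?_) hm
      rcases hcases (hI i hi) hj hm hx with h0 | ⟨k, hk, hk'⟩
      · rw [← lie_skew, h0, neg_zero]; exact Submodule.zero_mem _
      · rw [← lie_skew]
        exact Submodule.neg_mem _ (rootSpace_le_rootSpaceSum (h.add_mem i hi j hj k hk) hk')
    · refine lie_eq_zero_of_mem_biSup (fun i hi x hx j hj y hy ↦ ?_) hx hy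
      rcases hcases (hI i hi) (hI j hj) hx hy with h0 | ⟨k, hk, -⟩
      · exact h0
      · exact absurd ⟨k, hk⟩ (h.add_notMem i hi j hj)
  · intro h
    refine ⟨hI, ?_, fun i hi j hj k hk ↦ ?_⟩
    · rintro i hi j hj ⟨k, hk⟩
      obtain ⟨x, hx, hx0⟩ := exists_mem_rootSpace_ne_zero i
      obtain ⟨y, hy, hy0⟩ := exists_mem_rootSpace_ne_zero j
      exact lie_ne_zero_of_add_eq hk.symm hx hx0 hy hy0
        (h.lie_eq_zero x (rootSpace_le_rootSpaceSum hi hx) y (rootSpace_le_rootSpaceSum hj hy))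
    · obtain ⟨x, hx, hx0⟩ := exists_mem_rootSpace_ne_zero i
      obtain ⟨y, hy, hy0⟩ := exists_mem_rootSpace_ne_zero j
      have hne := lie_ne_zero_of_add_eq (hk.trans (add_comm _ _)).symm hy hy0 hx hx0
      refine mem_of_mem_rootSpaceSum ((rootSpace_eq_wt k).ge ?_) hne
        (h.lie_mem y (mem_borel_of_mem_rootSpace hj hy) x (rootSpace_le_rootSpaceSum hi hx))
      have := lie_mem_wt j hy (mem_wt_of_mem_rootSpace hx)
      rwa [← show k.1.toLinear = i.1.toLinear + j.1.toLinear from hk] at this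

end Borel

lemma isCommutativeSubalgebra_iff {K G : Type*} [Field K] [LieRing G] [LieAlgebra K G]
    {a : Submodule K G} : IsCommutativeSubalgebra a ↔ ∀ x ∈ a, ∀ y ∈ a, ⁅x, y⁆ = 0 := by
  constructor
  · rintro ⟨s, rfl, hs⟩ x hx y hy
    have : ⁅(⟨x, hx⟩ : s), (⟨y, hy⟩ : s)⁆ = 0 := trivial_lie_zero _ _ _ _
    exact congrArg Subtype.val this
  · intro h
    refine ⟨{ a with lie_mem' := fun {x y} hx hy ↦ ?_ }, rfl, ⟨fun x y ↦ Subtype.ext ?_⟩⟩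
    · rw [h x hx y hy]
      exact a.zero_mem
    · exact h x x.2 y y.2

/-! ### Long Abelian ideals and stable commutative subalgebras -/

section LittleAdjoint

variable {K G : Type*} [Field K] [CharZero K] [LieRing G] [LieAlgebra K G] [FiniteDimensional K G]
  {D : LieSubalgebra K G} [IsKilling K D] {H : LieSubalgebra K D} [H.IsCartanSubalgebra]
  [LieModule.IsTriangularizable K H D] {V : LieSubmodule K D G}
  {ι X Y : Type*} [Fintype ι] [AddCommGroup X] [Module K X] [AddCommGroup Y] [Module K Y]
  {P : RootPairing ι K X Y} {e : RootPairing.Equiv P.flip (rootSystem H)}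

lemma oddWt_eq_map (χ : Dual K H) : oddWt H V χ = (wt H V χ).map V.toSubmodule.subtype := by
  ext x
  constructor
  · rintro ⟨hx, hx'⟩
    exact ⟨⟨x, hx⟩, fun h ↦ Subtype.ext (hx' h), rfl⟩
  · rintro ⟨y, hy, rfl⟩
    exact ⟨y.2, fun h ↦ congrArg Subtype.val (hy h)⟩

lemma weightSpaceSum_image (I : Set ι) :
    weightSpaceSum H V (e.indexEquiv '' I) = ⨆ i ∈ I, oddWt H V (dualRoot e i) := by
  rw [weightSpaceSum, iSup_image]
  refine iSup_congr fun i ↦ iSup_congr fun _ ↦ ?_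
  rw [oddWt_eq_map]
  congr 1
  ext v
  exact LieModule.mem_weightSpace _ _

lemma oddWt_le_weightSpaceSum {I : Set ι} {i : ι} (hi : i ∈ I) :
    oddWt H V (dualRoot e i) ≤ weightSpaceSum H V (e.indexEquiv '' I) := by
  rw [weightSpaceSum_image]
  exact le_iSup₂_of_le i hi le_rfl

lemma mem_of_mem_weightSpaceSum {I : Set ι} {i : ι} {x : G} (hx0 : x ≠ 0)
    (hx : x ∈ wt H G (dualRoot e i)) (h : x ∈ weightSpaceSum H V (e.indexEquiv '' I)) :
    i ∈ I := by
  rw [weightSpaceSum_image, ← iSup_image (g := oddWt H V)] at h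
  obtain ⟨j, hj, hij⟩ := mem_of_mem_wt_of_mem_biSup (fun _ ↦ inf_le_right) hx0 hx h
  exact dualRoot_injective hij ▸ hj

lemma lie_mem_oddWt {α : H.root} {x : D} (hx : x ∈ rootSpace H α.1) {χ : Dual K H} {m : G}
    (hm : m ∈ oddWt H V χ) : ⁅x, m⁆ ∈ oddWt H V (χ + α.1.toLinear) :=
  ⟨V.lie_mem hm.1, lie_mem_wt α hx hm.2⟩

lemma IsStableCommutative.lie_mem_of_mem_rootSpace {S : Set H.root} {a : Submodule K G}
    (h : IsStableCommutative H V S a) {α : H.root} (hα : α ∈ S) {x : D}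
    (hx : x ∈ rootSpace H α.1) {m : G} (hm : m ∈ a) : ⁅x, m⁆ ∈ a :=
  h.lie_mem x (mem_borel_of_mem_rootSpace hα hx) m hm

lemma indexEquiv_mem_image {I : Set ι} {i : ι} (hi : i ∈ I) :
    e.indexEquiv i ∈ e.indexEquiv '' I := ⟨i, hi, rfl⟩

variable [P.IsCrystallographic] [P.IsReduced] [P.IsIrreducible] [P.IsRootSystem] {b : P.Base}
  {θ : ι}

lemma le_biSup_oddWt (hP : IsDoublyLaced P) (hθ : IsHighestRoot b θ)
    (hM : IsHighestWeightModule H (e.indexEquiv '' {i | b.IsPos i}) V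
      ((e.indexEquiv θ).1 : H → K)) :
    V.toSubmodule ≤ ⨆ χ ∈ insert 0 (dualRoot e '' {i | IsLong P i}), oddWt H V χ := by
  have htop := iSup_wt_eq_top hP hθ hM
  have := congrArg (Submodule.map (V.toSubmodule.subtype : V →ₗ[K] G)) htop
  rw [Submodule.map_top, Submodule.range_subtype] at this
  rw [← this]
  simp only [Submodule.map_iSup, oddWt_eq_map]
  exact le_rfl

lemma exists_mem_oddWt_ne_zero (hθ : IsHighestRoot b θ)
    (hM : IsHighestWeightModule H (e.indexEquiv '' {i | b.IsPos i}) V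
      ((e.indexEquiv θ).1 : H → K)) {i : ι} (hi : IsLong P i) :
    ∃ x ∈ oddWt H V (dualRoot e i), x ≠ 0 := by
  obtain ⟨v, hv, hv0⟩ := (Submodule.ne_bot_iff _).mp (wt_dualRoot_ne_bot hθ hM hi)
  refine ⟨v, ?_, fun h ↦ hv0 (Subtype.ext h)⟩
  rw [oddWt_eq_map]
  exact ⟨v, hv, rfl⟩

lemma dualRoot_add_ne_zero {i j : ι} (hi : b.IsPos i) (hj : b.IsPos j) :
    dualRoot e i + dualRoot e j ≠ 0 := by
  intro h
  have := dualRoot_injective ((eq_neg_of_add_eq_zero_left h).trans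
    (dualRoot_reflectionPerm_self j).symm)
  subst this
  exact (RootPairing.Base.IsPos.neg_iff_not b j).mp hi hj

/-- Long Abelian ideals give rise to stable commutative subalgebras. -/
lemma IsAbelianIdeal.isStableCommutative (hV : IsZ2Grading D V) (hP : IsDoublyLaced P)
    (hθ : IsHighestRoot b θ)
    (hM : IsHighestWeightModule H (e.indexEquiv '' {i | b.IsPos i}) V
      ((e.indexEquiv θ).1 : H → K)) {I : Set ι} (hI : IsAbelianIdeal b I)
    (hl : ∀ i ∈ I, IsLong P i) :
    IsStableCommutative H V (e.indexEquiv '' {i | b.IsPos i})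
      (weightSpaceSum H V (e.indexEquiv '' I)) := by
  refine ⟨?_, lie_mem_of_mem_borel (M := G) (fun h m hm ↦ ?_) ?_,
    isCommutativeSubalgebra_iff.mpr fun x hx y hy ↦ ?_⟩
  · rw [weightSpaceSum_image]
    exact iSup₂_le fun i hi ↦ inf_le_left
  · rw [weightSpaceSum_image] at hm ⊢
    refine lie_mem_of_mem_biSup (fun i hi m hm ↦ ?_) hm
    rw [hm.2 h, ← weightSpaceSum_image]
    exact Submodule.smul_mem _ _ (oddWt_le_weightSpaceSum hi hm)
  · rintro _ ⟨j, hj, rfl⟩ x hx m hm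
    rw [weightSpaceSum_image] at hm
    refine lie_mem_of_mem_biSup (fun i hi m hm ↦ ?_) hm
    by_cases h0 : ⁅x, m⁆ = 0
    · rw [h0]; exact Submodule.zero_mem _
    have hxm := lie_mem_oddWt hx hm
    change _ ∈ oddWt H V (dualRoot e i + dualRoot e j) at hxm
    rcases mem_of_mem_wt_of_mem_biSup (fun _ ↦ inf_le_right) h0 hxm.2
      (le_biSup_oddWt hP hθ hM hxm.1) with h | ⟨k, hk, hij⟩
    · exact absurd h (dualRoot_add_ne_zero (hI.isPos i hi) hj)
    · rw [← hij] at hxm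
      refine oddWt_le_weightSpaceSum ?_ hxm
      -- In the second case the root `i + j` is not long, yet it would belong to the ideal `I`.
      rcases hP.root_of_coroot_sub (hl i hi) hk (coroot_add_iff.mpr hij.symm) with h | ⟨l, hl', h⟩
      · exact hI.add_mem i hi j hj k h
      · exact absurd (hl l (hI.add_mem i hi j hj l h)) hl'
  · rw [weightSpaceSum_image] at hx hy
    refine lie_eq_zero_of_mem_biSup (fun i hi x hx j hj y hy ↦ ?_) hx hy
    by_contra h0
    have hD := hV.lie_mem x hx.1 y hy.1
    obtain ⟨α, hα⟩ := exists_root_of_mem_wt (x := (⟨⁅x, y⁆, hD⟩ : D))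
      (fun h ↦ h0 (congrArg Subtype.val h)) (dualRoot_add_ne_zero (hI.isPos i hi) (hI.isPos j hj))
      (mem_wt_of_coe (lie_mem_wt_add hx.2 hy.2))
    obtain ⟨k, -, hk⟩ := exists_dualRoot_eq (e := e) α
    rcases hP.root_of_coroot_add (hl i hi) (hl j hj) (coroot_add_iff.mpr (hk.trans hα).symm) with
      ⟨-, h⟩ | ⟨hk', l, h1, h2⟩
    · exact hI.add_notMem i hi j hj ⟨k, h⟩
    -- Whichever of `±l` is positive, adding it to `i` or to `j` puts the short root `k` into `I`.
    · rcases isPos_or_isPos_reflectionPerm_self (b := b) l with h | h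
      · exact hk' (hl k (hI.add_mem i hi l h k h1))
      · exact hk' (hl k (hI.add_mem j hj _ h k h2))

variable [IsKilling K G]

/-- Stable commutative subalgebras give rise to Abelian ideals. -/
lemma IsStableCommutative.isAbelianIdeal (hV : IsZ2Grading D V) (hP : IsDoublyLaced P)
    (hθ : IsHighestRoot b θ)
    (hM : IsHighestWeightModule H (e.indexEquiv '' {i | b.IsPos i}) V
      ((e.indexEquiv θ).1 : H → K)) {I : Set ι} (hI : IsLongPositive b I)
    (h : IsStableCommutative H V (e.indexEquiv '' {i | b.IsPos i})
      (weightSpaceSum H V (e.indexEquiv '' I))) : IsAbelianIdeal b I := by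
  have hspan : V.toSubmodule ≤ ⨆ χ, oddWt H V χ :=
    (le_biSup_oddWt hP hθ hM).trans (iSup₂_le fun χ _ ↦ le_iSup _ χ)
  have hcomm := isCommutativeSubalgebra_iff.mp h.commutative
  have hbracket {i j k : ι} (hi : i ∈ I) (hj : j ∈ I) (hk : P.coroot i + P.coroot j = P.coroot k)
      {n : ℕ} (hn : 0 < n) (hn' : P.pairingIn ℤ i k = n) : False := by
    obtain ⟨x, hx, hx0⟩ := exists_mem_oddWt_ne_zero hθ hM (hI i hi).2
    obtain ⟨y, hy, hy0⟩ := exists_mem_oddWt_ne_zero hθ hM (hI j hj).2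
    refine hV.lie_ne_zero hspan (coroot_add_iff.mp hk) hn ?_ hx hx0 hy hy0
      (hcomm x (oddWt_le_weightSpaceSum hi hx) y (oddWt_le_weightSpaceSum hj hy))
    have := dualRoot_apply_coroot (e := e) k i
    rw [hn'] at this
    exact_mod_cast this
  have hmem {i j k : ι} (hi : i ∈ I) (hj : b.IsPos j) (hk : P.coroot i + P.coroot j = P.coroot k)
      (hn : P.pairingIn ℤ j i = -1) : k ∈ I := by
    obtain ⟨m, hm, hm0⟩ := exists_mem_oddWt_ne_zero hθ hM (hI i hi).2
    obtain ⟨x, hx, hx0⟩ := exists_mem_rootSpace_ne_zero (e.indexEquiv j)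
    refine mem_of_mem_weightSpaceSum (lie_ne_zero_of_apply_coroot_neg hx hx0 hm.2 hm0 (n := -1)
      (by lia) (by rw [dualRoot_apply_coroot, hn])) ?_
      (h.lie_mem_of_mem_rootSpace (indexEquiv_mem_image hj) hx (oddWt_le_weightSpaceSum hi hm))
    rw [← coroot_add_iff.mp hk]
    exact lie_mem_wt _ hx hm.2
  refine ⟨fun i hi ↦ (hI i hi).1, ?_, fun i hi j hj k hk ↦ ?_⟩
  · rintro i hi j hj ⟨k, hk⟩
    obtain ⟨-, h1, -, h2⟩ := hP.coroot_of_root_add (hI i hi).2 (hI j hj).2 hk.symm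
    exact hbracket hi hj h1 one_pos h2
  · by_cases hjl : IsLong P j
    · obtain ⟨-, h1, h2, -⟩ := hP.coroot_of_root_add (hI i hi).2 hjl hk.symm
      exact hmem hi hj h1 h2
    · obtain ⟨h1, h2, l, -, -, h3, h4⟩ := hP.exists_of_root_add (hI i hi).2 hjl hk.symm
      exact (hbracket hi (hmem hi hj h3 h1) h4 two_pos h2).elim

/-- A stable commutative subalgebra contains no vectors of weight zero. -/
lemma IsStableCommutative.eq_zero_of_mem_wt_zero (hV : IsZ2Grading D V) (hP : IsDoublyLaced P)
    (hθ : IsHighestRoot b θ)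
    (hM : IsHighestWeightModule H (e.indexEquiv '' {i | b.IsPos i}) V
      ((e.indexEquiv θ).1 : H → K)) {a : Submodule K G}
    (h : IsStableCommutative H V (e.indexEquiv '' {i | b.IsPos i}) a) {u : G} (hua : u ∈ a)
    (hu : u ∈ wt H G 0) : u = 0 := by
  by_contra hu0
  have hspan : V.toSubmodule ≤ ⨆ χ, oddWt H V χ :=
    (le_biSup_oddWt hP hθ hM).trans (iSup₂_le fun χ _ ↦ le_iSup _ χ)
  have huV := h.le_odd hua
  obtain ⟨i, hi, x, hx, hxu⟩ := exists_lie_ne_zero hP hθ hM (u := (⟨u, huV⟩ : V))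
    (fun h ↦ hu0 (congrArg Subtype.val h)) (fun h ↦ Subtype.ext (hu h))
  obtain ⟨x', f, t, hx', hf⟩ := exists_sl2Triple (e.indexEquiv i)
  obtain ⟨c, rfl⟩ := exists_smul_eq_of_mem_rootSpace _ hx' t.e_ne_zero hx
  have hxu' : ⁅x', u⁆ ≠ 0 := by
    intro h0
    refine hxu (Subtype.ext ?_)
    change ⁅c • x', u⁆ = 0
    rw [smul_lie, h0, smul_zero]
  have hfu : ⁅f, u⁆ ≠ 0 := fun h0 ↦ hxu' (t.lie_e_eq_zero_of_lie_f_eq_zero (K := K)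
    (hu (coroot (e.indexEquiv i).1)) h0)
  have hw := lie_mem_oddWt hx' ⟨huV, hu⟩
  have hw' := lie_mem_oddWt hf ⟨huV, hu⟩
  rw [zero_add] at hw hw'
  rw [toLinear_reflectionPerm_self] at hw'
  -- The nonzero vector `[f, u]` must pair nontrivially with the line spanned by `[x', u]`. But
  -- `κ([f, u], [x', u]) = κ(f, [u, [x', u]])` vanishes, as `u` and `[x', u]` both lie in the
  -- commutative `a`.
  obtain ⟨y, hy, hne⟩ := hV.exists_killingForm_ne_zero hspan hw' hfu
  rw [neg_neg] at hy
  obtain ⟨d, rfl⟩ := hV.exists_smul_eq hspan _ hw hxu' hy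
  apply hne
  have hcomm := isCommutativeSubalgebra_iff.mp h.commutative u hua ⁅x', u⁆
    (h.lie_mem_of_mem_rootSpace (indexEquiv_mem_image hi) hx' hua)
  have hskew : ⁅f, u⁆ = -⁅u, (f : G)⁆ := (lie_skew (f : G) u).symm
  rw [map_smul, hskew, map_neg, LinearMap.neg_apply, killingForm_lie_left, hcomm, map_zero,
    neg_zero, neg_zero, smul_zero]

/-- Every stable commutative subalgebra arises from a set of long positive roots. -/
lemma IsStableCommutative.exists_eq_weightSpaceSum (hV : IsZ2Grading D V) (hP : IsDoublyLaced P)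
    (hθ : IsHighestRoot b θ)
    (hM : IsHighestWeightModule H (e.indexEquiv '' {i | b.IsPos i}) V
      ((e.indexEquiv θ).1 : H → K)) {a : Submodule K G}
    (h : IsStableCommutative H V (e.indexEquiv '' {i | b.IsPos i}) a) :
    ∃ I : Set ι, IsLongPositive b I ∧ weightSpaceSum H V (e.indexEquiv '' I) = a := by
  have hspan : V.toSubmodule ≤ ⨆ χ, oddWt H V χ :=
    (le_biSup_oddWt hP hθ hM).trans (iSup₂_le fun χ _ ↦ le_iSup _ χ)
  refine ⟨{i | b.IsPos i ∧ IsLong P i ∧ oddWt H V (dualRoot e i) ≤ a},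
    fun i hi ↦ ⟨hi.1, hi.2.1⟩, le_antisymm ?_ ?_⟩
  · rw [weightSpaceSum_image]
    exact iSup₂_le fun i hi ↦ hi.2.2
  refine (le_biSup_inf_of_stable (U := oddWt H V) (fun _ ↦ inf_le_right)
    (fun t ↦ h.lie_mem t (mem_borel_of_mem_cartan t))
    (h.le_odd.trans (le_biSup_oddWt hP hθ hM))).trans (iSup₂_le ?_)
  rintro _ (rfl | ⟨i, hi, rfl⟩) x ⟨hx, hxa⟩
  · rw [h.eq_zero_of_mem_wt_zero hV hP hθ hM hxa hx.2]
    exact Submodule.zero_mem _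
  by_cases hx0 : x = 0
  · rw [hx0]; exact Submodule.zero_mem _
  rcases isPos_or_isPos_reflectionPerm_self (b := b) i with hpos | hpos
  · refine oddWt_le_weightSpaceSum (i := i) (show _ ∧ _ ∧ _ from ⟨hpos, hi, fun y hy ↦ ?_⟩) hx
    obtain ⟨c, rfl⟩ := hV.exists_smul_eq hspan _ hx hx0 hy
    exact a.smul_mem c hxa
  -- A root vector for the positive root `-i` acts injectively on weight `i^∨`, where its coroot
  -- takes the value `-2`, and it would yield a nonzero vector of weight zero in `a`.
  · exfalso
    obtain ⟨y, hy, hy0⟩ := exists_mem_rootSpace_ne_zero (e.indexEquiv (P.reflectionPerm i i))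
    refine lie_ne_zero_of_apply_coroot_neg hy hy0 hx.2 hx0 (n := -2) (by lia) ?_
      (h.eq_zero_of_mem_wt_zero hV hP hθ hM
        (h.lie_mem_of_mem_rootSpace (indexEquiv_mem_image hpos) hy hxa) ?_)
    · rw [dualRoot_apply_coroot, RootPairing.pairingIn_reflectionPerm_self_left,
        RootPairing.pairingIn_same]
    · have := lie_mem_wt _ hy hx.2
      change _ ∈ wt H G (dualRoot e i + dualRoot e (P.reflectionPerm i i)) at this
      rwa [dualRoot_reflectionPerm_self, add_neg_cancel] at this

lemma bijOn_weightSpaceSum (hV : IsZ2Grading D V) (hP : IsDoublyLaced P)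
    (hθ : IsHighestRoot b θ)
    (hM : IsHighestWeightModule H (e.indexEquiv '' {i | b.IsPos i}) V
      ((e.indexEquiv θ).1 : H → K)) :
    Set.BijOn (fun I : Set ι ↦ weightSpaceSum H V (e.indexEquiv '' I))
      {I | IsLongPositive b I ∧ IsAbelianIdeal b I}
      {a | IsStableCommutative H V (e.indexEquiv '' {i | b.IsPos i}) a} := by
  have hsub {I J : Set ι} (hI : IsLongPositive b I)
      (hIJ : weightSpaceSum H V (e.indexEquiv '' I) ≤ weightSpaceSum H V (e.indexEquiv '' J)) :
      I ⊆ J := by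
    intro i hi
    obtain ⟨x, hx, hx0⟩ := exists_mem_oddWt_ne_zero hθ hM (hI i hi).2
    exact mem_of_mem_weightSpaceSum hx0 hx.2 (hIJ (oddWt_le_weightSpaceSum hi hx))
  refine ⟨fun I hI ↦ hI.2.isStableCommutative hV hP hθ hM fun i hi ↦ (hI.1 i hi).2,
    fun I hI J hJ hIJ ↦ (hsub hI.1 hIJ.le).antisymm (hsub hJ.1 hIJ.ge), fun a ha ↦ ?_⟩
  obtain ⟨I, hI, rfl⟩ := IsStableCommutative.exists_eq_weightSpaceSum hV hP hθ hM ha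
  exact ⟨I, ⟨hI, IsStableCommutative.isAbelianIdeal hV hP hθ hM hI ha⟩, rfl⟩

end LittleAdjoint

end LongAbelian

theorem mainTheorem2
    {K : Type*} [Field K] [CharZero K] [IsAlgClosed K]
    -- the Lie algebra `L` with its Cartan subalgebra, simple roots, `θ` and `θ_s`
    {L : Type*} [LieRing L] [LieAlgebra K L] [FiniteDimensional K L] [LieAlgebra.IsSimple K L]
    (H : LieSubalgebra K L) [H.IsCartanSubalgebra]
    (b : (rootSystem H).Base) (θ θs : H.root)
    (hθ : LongAbelian.IsHighestRoot b θ)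
    (hθs : LongAbelian.IsShort (rootSystem H) θs ∧ LongAbelian.IsDominant b θs)
    (hratio : LongAbelian.sqLength (rootSystem H) θ = 2 * LongAbelian.sqLength (rootSystem H) θs)
    -- the simple graded Lie algebra `G = D ⊕ V`, where `D` is dual to `L` via the
    -- identification `e : α^∨ ↦ e α` of the dual root system with the root system of `D`,
    -- and `V` is the `D`-module with highest weight `θ^∨`
    {G : Type*} [LieRing G] [LieAlgebra K G] [FiniteDimensional K G] [LieAlgebra.IsSimple K G]
    (D : LieSubalgebra K G) [LieAlgebra.IsSimple K D]
    (HD : LieSubalgebra K D) [HD.IsCartanSubalgebra]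
    (e : RootPairing.Equiv (rootSystem H).flip (rootSystem HD))
    (V : LieSubmodule K D G) (hV : LongAbelian.IsZ2Grading D V)
    (hVθ : LongAbelian.IsHighestWeightModule HD (e.indexEquiv '' {i | b.IsPos i}) V
      ((e.indexEquiv θ).1 : HD → K)) :
    (∀ I : Set H.root, LongAbelian.IsLongPositive b I →
      (LongAbelian.IsAbelianIdeal b I ↔
        LongAbelian.IsStableCommutative HD V (e.indexEquiv '' {i | b.IsPos i})
          (LongAbelian.weightSpaceSum HD V (e.indexEquiv '' I))) ∧
      (LongAbelian.IsAbelianBorelIdeal H {i | b.IsPos i} (LongAbelian.rootSpaceSum H I) ↔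
        LongAbelian.IsStableCommutative HD V (e.indexEquiv '' {i | b.IsPos i})
          (LongAbelian.weightSpaceSum HD V (e.indexEquiv '' I)))) ∧
    Set.BijOn (fun I : Set H.root ↦ LongAbelian.weightSpaceSum HD V (e.indexEquiv '' I))
      {I | LongAbelian.IsLongPositive b I ∧ LongAbelian.IsAbelianIdeal b I}
      {a | LongAbelian.IsStableCommutative HD V (e.indexEquiv '' {i | b.IsPos i}) a} := by
  have hP := LongAbelian.isDoublyLaced_of_sqLength_eq hθ.isLong hratio
  have hiff (I : Set H.root) (hI : LongAbelian.IsLongPositive b I) :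
      LongAbelian.IsAbelianIdeal b I ↔
        LongAbelian.IsStableCommutative HD V (e.indexEquiv '' {i | b.IsPos i})
          (LongAbelian.weightSpaceSum HD V (e.indexEquiv '' I)) :=
    ⟨fun h ↦ h.isStableCommutative hV hP hθ hVθ fun i hi ↦ (hI i hi).2,
      fun h ↦ h.isAbelianIdeal hV hP hθ hVθ hI⟩
  refine ⟨fun I hI ↦ ⟨hiff I hI, ?_⟩, LongAbelian.bijOn_weightSpaceSum hV hP hθ hVθ⟩
  rw [← hiff I hI, LongAbelian.isAbelianIdeal_iff_isAbelianBorelIdeal fun i hi ↦ (hI i hi).1]
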